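/- Consider the reentrant flow shop $F\,|\,reentry,\,p_{ijk}=1\,|\,\sum w_jC_j$. An instance $I$ consists of $m\ge 1$ machines in series and $n\ge 1$ jobs; job $j$ has a weight $w_j>0$ (a real number) and has to traverse the shop $L_j\ge 1$ times. In each of its $L_j$ loops, job $j$ visits machines $1,\dots,m$ in this order, with processing time $1$ on each machine; a loop of a job may start on machine $1$ only after the preceding loop of the same job has been completed on machine $m$; and every machine processes at most one loop at a time. Schedules start at time $0$. Let $C_j$ be the completion time of the last loop of job $j$ on machine $m$; the objective is to minimize $\sum_j w_jC_j$. The Weighted Least Remaining Loops (WLRL) rule never leaves machine $1$ idle while a job is available (a job is available at time $t$ if it still has a loop to start and all its loops started so far are completed by time $t$). Whenever machine $1$ is free and jobs are available, it starts the next loop of an available job with the largest ratio of weight to number of remaining loops; equivalently, of an available job with the largest ratio $w_j/L_j$, where ties are broken in favour of a job that has already been started. All other ties are broken arbitrarily. A loop that has been started moves through machines $1,\dots,m$ without waiting. Theorem. For every instance $I$, a WLRL schedule exists, and an optimal schedule exists which moreover can be chosen to be a permutation schedule (all machines process the loops in the same order). In either form of the rule: (a) for every instance $I$, every WLRL schedule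 $\sigma$ and every optimal schedule $\tau$ of $I$, $$\frac{\sum_j w_jC_j(\sigma)}{\sum_j w_jC_j(\tau)}\;\le\;\frac{1+\sqrt2}{2};$$ (b) this bound is tight: for every real $\alpha<\frac{1+\sqrt2}{2}$ there is an instance $I$ such that $\sum_j w_jC_j(\sigma)>\alpha\sum_j w_jC_j(\tau)$ for every WLRL schedule $\sigma$ and every optimal schedule $\tau$ of $I$. -/

import Mathlib

/-- An instance of the reentrant flow shop with unit processing times:
`m` machines in series, `n` jobs, job `j` traverses the shop `loops j` times and has weight `w j`. -/
structure ReentrantShop where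
  m : ℕ
  n : ℕ
  loops : Fin n → ℕ
  w : Fin n → ℝ
  m_pos : 0 < m
  n_pos : 0 < n
  loops_pos : ∀ j, 0 < loops j
  w_pos : ∀ j, 0 < w j

/-- The two descriptions of the priority in the WLRL rule: the weight divided by the number of
loops that the job still has to start (`remaining`), or the weight divided by the total number of
loops of the job, ties being resolved in favour of a job that has already been started (`total`). -/
inductive WLRLVariant
  | remaining
  | total

namespace ReentrantShop

/-- The loop `⟨j, k⟩` is the `(k + 1)`-st loop of job `j`. -/
abbrev Loop (I : ReentrantShop) : Type := Σ j : Fin I.n, Fin (I.loops j)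

/-- A (not necessarily feasible) schedule: the start time of every loop on every machine. -/
abbrev Schedule (I : ReentrantShop) : Type := Fin I.m → I.Loop → ℝ

def firstMachine (I : ReentrantShop) : Fin I.m := ⟨0, I.m_pos⟩

def lastMachine (I : ReentrantShop) : Fin I.m := ⟨I.m - 1, Nat.sub_lt I.m_pos Nat.one_pos⟩

def lastLoop (I : ReentrantShop) (j : Fin I.n) : I.Loop :=
  ⟨j, ⟨I.loops j - 1, Nat.sub_lt (I.loops_pos j) Nat.one_pos⟩⟩

/-- Start time of a loop on the first machine. -/
def start (I : ReentrantShop) (σ : I.Schedule) (l : I.Loop) : ℝ := σ I.firstMachine l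

/-- Completion time of a loop on the last machine. -/
def completion (I : ReentrantShop) (σ : I.Schedule) (l : I.Loop) : ℝ := σ I.lastMachine l + 1

/-- Completion time of a job. -/
def jobCompletion (I : ReentrantShop) (σ : I.Schedule) (j : Fin I.n) : ℝ :=
  I.completion σ (I.lastLoop j)

/-- Total weighted completion time. -/
def cost (I : ReentrantShop) (σ : I.Schedule) : ℝ := ∑ j, I.w j * I.jobCompletion σ j

structure IsFeasible (I : ReentrantShop) (σ : I.Schedule) : Prop where
  nonneg : ∀ i l, 0 ≤ σ i l
  /-- every loop visits the machines in their order -/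
  route : ∀ (i i' : Fin I.m) (l : I.Loop), (i : ℕ) + 1 = i' → σ i l + 1 ≤ σ i' l
  /-- a loop starts only after the previous loop of the same job has left the last machine -/
  reentry : ∀ (j : Fin I.n) (k k' : Fin (I.loops j)), (k : ℕ) + 1 = k' →
    I.completion σ ⟨j, k⟩ ≤ I.start σ ⟨j, k'⟩
  /-- every machine processes at most one loop at a time -/
  capacity : ∀ (i : Fin I.m) (l l' : I.Loop), l ≠ l' → σ i l + 1 ≤ σ i l' ∨ σ i l' + 1 ≤ σ i l

/-- All machines process the loops in the same order. -/
def IsPermutation (I : ReentrantShop) (σ : I.Schedule) : Prop :=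
  ∀ (i i' : Fin I.m) (l l' : I.Loop), σ i l < σ i l' → σ i' l < σ i' l'

def IsOptimal (I : ReentrantShop) (σ : I.Schedule) : Prop :=
  I.IsFeasible σ ∧ ∀ τ : I.Schedule, I.IsFeasible τ → I.cost σ ≤ I.cost τ

/-- At time `t` the job of `l` is available and `l` is its next loop: `l` has not been started
before `t`, and all earlier loops of the job are completed by time `t`. -/
def IsAvailable (I : ReentrantShop) (σ : I.Schedule) (l : I.Loop) (t : ℝ) : Prop :=
  t ≤ I.start σ l ∧ ∀ k : Fin (I.loops l.1), k < l.2 → I.completion σ ⟨l.1, k⟩ ≤ t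

/-- Weight over number of remaining loops, when `l` is the next loop of its job. -/
noncomputable def remainingRatio (I : ReentrantShop) (l : I.Loop) : ℝ :=
  I.w l.1 / ((I.loops l.1 : ℝ) - (l.2 : ℕ))

/-- Weight over total number of loops. -/
noncomputable def totalRatio (I : ReentrantShop) (l : I.Loop) : ℝ :=
  I.w l.1 / (I.loops l.1 : ℝ)

/-- The next loop `l'` has strictly higher WLRL priority than the next loop `l`. -/
def Precedes (I : ReentrantShop) : WLRLVariant → I.Loop → I.Loop → Prop
  | .remaining, l', l => I.remainingRatio l < I.remainingRatio l'
  | .total, l', l => I.totalRatio l < I.totalRatio l' ∨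
      (I.totalRatio l = I.totalRatio l' ∧ (l.2 : ℕ) = 0 ∧ 0 < (l'.2 : ℕ))

/-- `σ` is a schedule generated by the WLRL rule (with some choice among loops of equal
priority). -/
structure IsWLRL (I : ReentrantShop) (v : WLRLVariant) (σ : I.Schedule) : Prop where
  feasible : I.IsFeasible σ
  /-- once started on the first machine, a loop passes through the shop without waiting -/
  no_wait : ∀ (i : Fin I.m) (l : I.Loop), σ i l = I.start σ l + (i : ℕ)
  /-- the first machine is not idle while a job is available -/
  busy : ∀ (t : ℝ) (l : I.Loop), 0 ≤ t → I.IsAvailable σ l t →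
    ∃ l' : I.Loop, I.start σ l' ≤ t ∧ t < I.start σ l' + 1
  /-- whenever a loop is started, no available job has higher priority -/
  select : ∀ l l' : I.Loop, I.IsAvailable σ l' (I.start σ l) → ¬ I.Precedes v l' l

end ReentrantShop

/-! Put `ρ = (1 + √2) / 2`. Rounding start times on machine 1 down to integers turns any feasible
schedule into an assignment of distinct integer slots, consecutive loops of a job being at least `m`
apart, without raising the cost. This gives an optimal permutation schedule, since only finitely
many slottings are as cheap as a given one. Under either form of the rule a started job beats every
waiting one and never pauses, so WLRL schedules are list schedules: by nonincreasing `w_j / L_j`,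
each job takes the first idle slot `s_j` and then `s_j + m`, `s_j + 2m`, …
(`IsWLRL.exists_listSchedule`, `IsListSchedule.isWLRL`).

For the upper bound, write `w_j = ratio j * L_j`. Abel summation over the level sets of `ratio`
reduces the claim to weights `w_j = L_j`, because a level set of a list schedule is again a list
schedule. Then `L_j * C_j` is at least the sum of the slots of job `j` plus `m * L_j * (L_j + 1) /
2`, with equality for contiguous jobs, so sums of slots are compared (`list_schedule_bound`). Let
`T` be the first idle slot of the list schedule. If `T ≤ m`, a perfect square settles each job. If
`m ≤ T`, the competitor's slots are distinct naturals, whose sum is bounded below by cutting at the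
threshold `√2 * T - 1 / 2`. At most `m - 1` jobs run past `T`, and each is handled by
`overhanging_job_bound`.

For tightness, unit jobs of ratio 1 delay `k` long jobs of ratio just below 1. It is better to give
the long jobs `k` residues modulo `m` from the start and to run the unit jobs in the other residues.
With `m / (m - k)` near `√2` and a large scale, the ratio of costs approaches `ρ`. -/

/-! ### Sums of positive parts. -/

/-- Removing the term `a = 0` replaces `h` by `h - 1`, and `(h + 1/2)² / 2 - h = (h - 1/2)² / 2`.
For `h ≤ 1` the claim is `(h - 1/2)² ≥ 0`. For large `B` the bound is attained at half-integers,
which is why thresholds of the form `T - 1/2` occur below. -/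
theorem sum_range_pos_part_le (B : ℕ) : ∀ h : ℝ, 0 ≤ h →
    ∑ a ∈ Finset.range B, max (h - a) 0 ≤ (h + 1 / 2) ^ 2 / 2 := by
  induction B with
  | zero => intro h hh; simp; positivity
  | succ B ih =>
    intro h hh
    rw [Finset.sum_range_succ']
    have hshift : ∀ a : ℕ, h - ((a + 1 : ℕ) : ℝ) = (h - 1) - a := by intro a; push_cast; ring
    simp only [hshift, Nat.cast_zero, sub_zero]
    rw [max_eq_left hh]
    rcases le_total 1 h with h1 | h1
    · have := ih (h - 1) (by linarith)
      nlinarith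
    · have h0 : ∑ a ∈ Finset.range B, max (h - 1 - (a : ℝ)) 0 = 0 := by
        apply Finset.sum_eq_zero
        intro a _
        have : (0 : ℝ) ≤ a := a.cast_nonneg
        exact max_eq_right (by linarith)
      rw [h0]
      nlinarith [sq_nonneg (h - 1 / 2)]

/-- Lower bound for a sum of distinct naturals, split at a threshold `h`. -/
theorem le_sum_of_injOn {κ : Type*} (S : Finset κ) (x : κ → ℕ) (hx : Set.InjOn x S)
    (h : ℝ) (hh : 0 ≤ h) :
    h * S.card - (h + 1 / 2) ^ 2 / 2 + ∑ l ∈ S, max ((x l : ℝ) - h) 0 ≤ ∑ l ∈ S, (x l : ℝ) := by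
  have key : ∑ l ∈ S, max (h - (x l : ℝ)) 0 ≤ (h + 1 / 2) ^ 2 / 2 := by
    rw [← Finset.sum_image (f := fun a : ℕ => max (h - (a : ℝ)) 0) hx]
    refine le_trans ?_ (sum_range_pos_part_le ((S.image x).sup id + 1) h hh)
    apply Finset.sum_le_sum_of_subset_of_nonneg
    · intro a ha
      exact Finset.mem_range.2 (Nat.lt_succ_of_le (Finset.le_sup (f := id) ha))
    · intros; exact le_max_right _ _
  have split : ∀ l ∈ S, (x l : ℝ) = h - max (h - (x l : ℝ)) 0 + max ((x l : ℝ) - h) 0 := by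
    intro l _
    rcases le_total h (x l) with hl | hl
    · rw [max_eq_right (by linarith), max_eq_left (by linarith)]; ring
    · rw [max_eq_left (by linarith), max_eq_right (by linarith)]; ring
  rw [Finset.sum_congr rfl split, Finset.sum_add_distrib, Finset.sum_sub_distrib,
    Finset.sum_const, nsmul_eq_mul]
  linarith

/-- Once `h ≤ m * L`, both sides grow by `2 * m * (m * L - h)` when `L` increases by one. At the
first such `L` the left side is not positive. -/
theorem le_sum_arith_pos_part (m h : ℝ) (hm : 0 ≤ m) (hh : 0 ≤ h) (L : ℕ) (hL : h ≤ m * L) :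
    (m * L - h) * (m * L - h - m) ≤ 2 * m * ∑ k ∈ Finset.range L, max (k * m - h) 0 := by
  induction L with
  | zero =>
    have : h = 0 := by simp at hL; linarith
    simp [this]
  | succ L ih =>
    rw [Finset.sum_range_succ]
    push_cast at hL ⊢
    rcases le_total h (m * L) with h1 | h1
    · have := ih h1
      rw [max_eq_left (by linarith)]
      nlinarith
    · have h0 : 0 ≤ ∑ k ∈ Finset.range L, max ((k : ℝ) * m - h) 0 :=
        Finset.sum_nonneg fun _ _ => le_max_right _ _
      rw [max_eq_right (by linarith)]
      have : (m * (L + 1) - h) * (m * (L + 1) - h - m) ≤ 0 :=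
        mul_nonpos_of_nonneg_of_nonpos (by linarith) (by linarith)
      nlinarith [mul_nonneg hm h0]

/-! ### The quadratic inequality for one overhanging job. -/

set_option maxHeartbeats 1000000 in
/-- The inequality of a job that runs beyond the first idle slot `T`: it has `b` loops before `T`
and `c` loops after `T`. -/
theorem overhanging_job_bound (m T b c G : ℝ) (hm : 2 ≤ m) (hT : m ≤ T) (hb : 1 ≤ b) (hc : 0 ≤ c)
    (hG : 0 ≤ G)
    (hG' : √2 * T - 1 / 2 ≤ m * (b + c) →
      (m * (b + c) - (√2 * T - 1 / 2)) * (m * (b + c) - (√2 * T - 1 / 2) - m) ≤ m * G) :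
    2 * c * (T + m - 1) + m * c * (c - 1)
        - ((1 + √2) / 2 - 1) * (m * (b + c) * (b + c + 1) - 2 * m * b) ≤
      (1 + √2) / 2 * (2 * (√2 * T - 1 / 2) * c + G) + 2 * ((1 + √2) / 2 - 1) * T := by
  have hr2 : √2 * √2 = 2 := Real.mul_self_sqrt (by norm_num)
  have hr0 : 1.414 < √2 := by
    rw [Real.lt_sqrt (by norm_num)]; norm_num
  have hr1 : √2 < 1.415 := by
    rw [Real.sqrt_lt' (by norm_num)]; norm_num
  generalize √2 = r at *
  -- If the length of the job is below the threshold, only `0 ≤ G` is needed, and an inequality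
  -- linear in the data, multiplied by `c`, suffices.
  by_cases hcase : m * (b + c) ≤ r * T - 1 / 2
  · have hmb : m ≤ m * b := by nlinarith
    have h1 : 2 * (T + m - 1) + m * (c - 1) - 2 * ((1 + r) / 2 - 1) * m
        ≤ (1 + r) / 2 * (2 * (r * T - 1 / 2)) := by nlinarith
    have h2 := mul_le_mul_of_nonneg_left h1 hc
    have h3 : 0 ≤ ((1 + r) / 2 - 1) * (m * ((b + c) * (b + c - 1))) := by
      apply mul_nonneg (by linarith)
      apply mul_nonneg (by linarith)
      apply mul_nonneg <;> linarith
    have h4 : 0 ≤ (1 + r) / 2 * G := mul_nonneg (by linarith) hG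
    have h5 : 0 ≤ 2 * ((1 + r) / 2 - 1) * T := mul_nonneg (by linarith) (by linarith)
    nlinarith
  · push Not at hcase
    have hG'' := hG' hcase.le
    obtain ⟨h, hh⟩ : ∃ h, h = r * T - 1 / 2 := ⟨_, rfl⟩
    rw [← hh] at hG'' hcase ⊢
    obtain ⟨q, hq⟩ : ∃ q, q = m * (b + c) := ⟨_, rfl⟩
    obtain ⟨z, hz⟩ : ∃ z, z = m * c := ⟨_, rfl⟩
    rw [← hq] at hG'' hcase
    have hz0 : 0 ≤ z := by rw [hz]; exact mul_nonneg (by linarith) hc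
    have hzq : z ≤ q - m := by rw [hz, hq]; nlinarith
    have hrT : m ≤ T := hT
    have hqm : m < q := by nlinarith
    have at0 : 0 ≤ (1 + r) / 2 * ((q - h) * (q - h - m)) + (r - 1) * T * m
        + ((1 + r) / 2 - 1) * (q ^ 2 - m * q) := by
      have e1 : -(m ^ 2 / 4) ≤ (q - h) * (q - h - m) := by nlinarith [sq_nonneg (q - h - m / 2)]
      have e2 : (1 + r) / 2 * (-(m ^ 2 / 4)) ≤ (1 + r) / 2 * ((q - h) * (q - h - m)) :=
        mul_le_mul_of_nonneg_left e1 (by linarith)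
      have e3 : 0 ≤ ((1 + r) / 2 - 1) * (q ^ 2 - m * q) :=
        mul_nonneg (by linarith) (by nlinarith)
      have e4 : (r - 1) * (m * m) ≤ (r - 1) * (T * m) :=
        mul_le_mul_of_nonneg_left (by nlinarith) (by linarith)
      nlinarith [mul_pos (show 0 < m by linarith) (show 0 < m by linarith)]
    -- The `T²` terms cancel because `r² = 2`; what remains is linear in `T` and is handled using `m
    -- ≤ T`.
    have disc : 0 ≤ h * (h - m) / 2 + (r - 1) ^ 2 * T * m - (T - 1 - (r - 1) * m) ^ 2 := by
      have e : h * (h - m) / 2 + (r - 1) ^ 2 * T * m - (T - 1 - (r - 1) * m) ^ 2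
          = (2 - r / 2) * T + (1 - r / 2) * (T * m) - 7 / 8 + m * (9 / 4 - 2 * r)
            - (3 - 2 * r) * m ^ 2 := by
        rw [hh]
        linear_combination (T ^ 2 / 2 + T * m - m ^ 2) * hr2
      rw [e]
      have e1 : (2 - r / 2) * m ≤ (2 - r / 2) * T := mul_le_mul_of_nonneg_left hT (by linarith)
      have e2 : (1 - r / 2) * (m * m) ≤ (1 - r / 2) * (T * m) :=
        mul_le_mul_of_nonneg_left (by nlinarith) (by linarith)
      nlinarith
    have atZ : 0 ≤ (r - 1) * (q - m) ^ 2 + (q - m) * (-2 * T + 2 + 2 * (r - 1) * m)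
        + (1 + r) / 2 * (h * (h - m)) + (r - 1) * T * m := by
      have e : (r - 1) * ((r - 1) * (q - m) ^ 2 + (q - m) * (-2 * T + 2 + 2 * (r - 1) * m)
          + (1 + r) / 2 * (h * (h - m)) + (r - 1) * T * m)
          = ((r - 1) * (q - m) - (T - 1 - (r - 1) * m)) ^ 2
            + (h * (h - m) / 2 + (r - 1) ^ 2 * T * m - (T - 1 - (r - 1) * m) ^ 2) := by
        linear_combination (h * (h - m) / 2) * hr2
      have : 0 ≤ (r - 1) * ((r - 1) * (q - m) ^ 2 + (q - m) * (-2 * T + 2 + 2 * (r - 1) * m)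
          + (1 + r) / 2 * (h * (h - m)) + (r - 1) * T * m) := by
        rw [e]; positivity
      exact nonneg_of_mul_nonneg_right this (by linarith)
    -- The expression is a quadratic in `z` with leading coefficient `-1`, hence concave, so it is
    -- enough to check the ends of `[0, q - m]`: these are `at0` and `atZ`. The range of `z` comes
    -- from `1 ≤ b`.
    have conc : 0 ≤ (1 + r) * h * z + (1 + r) / 2 * ((q - h) * (q - h - m)) + (r - 1) * T * m
        - (2 * T + m - 2) * z - z ^ 2 + ((1 + r) / 2 - 1) * (q ^ 2 - m * q + 2 * m * z) := by
      have id : (q - m) * ((1 + r) * h * z + (1 + r) / 2 * ((q - h) * (q - h - m))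
          + (r - 1) * T * m - (2 * T + m - 2) * z - z ^ 2
          + ((1 + r) / 2 - 1) * (q ^ 2 - m * q + 2 * m * z))
          = (q - m - z) * ((1 + r) / 2 * ((q - h) * (q - h - m)) + (r - 1) * T * m
              + ((1 + r) / 2 - 1) * (q ^ 2 - m * q))
            + z * ((r - 1) * (q - m) ^ 2 + (q - m) * (-2 * T + 2 + 2 * (r - 1) * m)
              + (1 + r) / 2 * (h * (h - m)) + (r - 1) * T * m)
            + (q - m) * z * (q - m - z) := by ring
      have : 0 ≤ (q - m) * ((1 + r) * h * z + (1 + r) / 2 * ((q - h) * (q - h - m))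
          + (r - 1) * T * m - (2 * T + m - 2) * z - z ^ 2
          + ((1 + r) / 2 - 1) * (q ^ 2 - m * q + 2 * m * z)) := by
        rw [id]
        have := mul_nonneg (show 0 ≤ q - m - z by linarith) at0
        have := mul_nonneg hz0 atZ
        have := mul_nonneg (mul_nonneg (show 0 ≤ q - m by linarith) hz0)
          (show 0 ≤ q - m - z by linarith)
        linarith
      exact nonneg_of_mul_nonneg_right this (by linarith)
    have hρG := mul_le_mul_of_nonneg_left hG'' (show 0 ≤ (1 + r) / 2 by linarith)
    have hfin : 0 ≤ m * ((1 + r) / 2 * (2 * h * c + G) + 2 * ((1 + r) / 2 - 1) * T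
        - (2 * c * (T + m - 1) + m * c * (c - 1)
        - ((1 + r) / 2 - 1) * (m * (b + c) * (b + c + 1) - 2 * m * b))) := by
      have e : m * ((1 + r) / 2 * (2 * h * c + G) + 2 * ((1 + r) / 2 - 1) * T
        - (2 * c * (T + m - 1) + m * c * (c - 1)
        - ((1 + r) / 2 - 1) * (m * (b + c) * (b + c + 1) - 2 * m * b)))
        = (1 + r) * h * z + (1 + r) / 2 * (m * G) + (r - 1) * T * m
        - (2 * T + m - 2) * z - z ^ 2 + ((1 + r) / 2 - 1) * (q ^ 2 - m * q + 2 * m * z) := by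
        rw [hq, hz]; ring
      rw [e]; linarith
    have := nonneg_of_mul_nonneg_right hfin (by linarith)
    linarith

/-! ### Slots of a single job, and idle slots. -/

theorem add_mul_le_of_step {m L : ℕ} {x : ℕ → ℕ} (hx : ∀ k, k + 1 < L → x k + m ≤ x (k + 1))
    (k d : ℕ) (hk : k + d < L) : x k + d * m ≤ x (k + d) := by
  induction d with
  | zero => simp
  | succ d ih =>
    have h1 := ih (by omega)
    have h2 := hx (k + d) (by omega)
    rw [← add_assoc]
    linarith [Nat.succ_mul d m]

theorem sum_range_arith (a m : ℝ) (c : ℕ) :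
    ∑ k ∈ Finset.range c, (a + k * m) = c * a + m * c * (c - 1) / 2 := by
  induction c with
  | zero => simp
  | succ c ih => rw [Finset.sum_range_succ, ih]; push_cast; ring

/-- Lower bound for the completion time of a job in terms of the slots of its loops. -/
theorem sum_slots_le_mul_completion {m L : ℕ} {x : ℕ → ℕ}
    (hx : ∀ k, k + 1 < L → x k + m ≤ x (k + 1)) :
    2 * ∑ k ∈ Finset.range L, (x k : ℝ) + m * L * (L + 1) ≤ 2 * (L * (x (L - 1) + m)) := by
  have h : ∀ k ∈ Finset.range L, (x k : ℝ) ≤ (x (L - 1) - m * (L - 1)) + k * m := by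
    intro k hk
    have hk := Finset.mem_range.1 hk
    obtain ⟨d, rfl⟩ : ∃ d, L = k + d + 1 := ⟨L - 1 - k, by omega⟩
    have := add_mul_le_of_step hx k d (by omega)
    have h' : (x k : ℝ) + d * m ≤ x (k + d) := by exact_mod_cast this
    simp only [Nat.add_sub_cancel]
    push_cast
    linarith
  have := Finset.sum_le_sum h
  rw [sum_range_arith] at this
  linarith

/-- The slots of a run of loops, split at the threshold `T`. -/
theorem exists_loops_before {m : ℕ} (s L T : ℕ) (hL : 0 < L) (hs : s < T) :
    ∃ b, 1 ≤ b ∧ b ≤ L ∧ (∀ k < b, s + k * m < T) ∧ (b < L → T ≤ s + b * m) := by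
  classical
  have ex : ∃ b, b = L ∨ T ≤ s + b * m := ⟨L, Or.inl rfl⟩
  refine ⟨Nat.find ex, ?_, ?_, ?_, ?_⟩
  · by_contra h
    have h0 : Nat.find ex = 0 := by omega
    have := Nat.find_spec ex
    rw [h0] at this
    simp at this
    omega
  · exact Nat.find_min' ex (Or.inl rfl)
  · intro k hk
    have := Nat.find_min ex hk
    push Not at this
    exact this.2
  · intro h
    rcases Nat.find_spec ex with h' | h'
    · omega
    · exact h'

theorem exists_idle_slot {ι : Type*} (A : Finset ι) (m : ℕ) (L s : ι → ℕ) :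
    ∃ t, ¬ ∃ j ∈ A, ∃ k < L j, s j + k * m = t := by
  classical
  obtain ⟨t, ht⟩ := Infinite.exists_notMem_finset ((A.sigma fun j => Finset.range (L j)).image
    (fun p : Σ _ : ι, ℕ => s p.1 + p.2 * m))
  refine ⟨t, ?_⟩
  rintro ⟨j, hj, k, hk, rfl⟩
  exact ht (Finset.mem_image.2 ⟨⟨j, k⟩, by simp [hj, hk], rfl⟩)

/-! ### List schedules against arbitrary slottings, for weights equal to the numbers of loops. -/

section ListSchedule

variable {ι : Type*} (A : Finset ι) (m : ℕ) (L s : ι → ℕ) (x : ι → ℕ → ℕ)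

/-- A list schedule in which no machine gets a second job. -/
theorem list_schedule_bound_of_le (hm : 0 < m) (hL : ∀ j ∈ A, 0 < L j)
    (hinj : ∀ j ∈ A, ∀ j' ∈ A, ∀ k < L j, ∀ k' < L j', s j + k * m = s j' + k' * m →
      j = j' ∧ k = k')
    (hxinj : ∀ j ∈ A, ∀ j' ∈ A, ∀ k < L j, ∀ k' < L j', x j k = x j' k' → j = j' ∧ k = k')
    (hstep : ∀ j ∈ A, ∀ k, k + 1 < L j → x j k + m ≤ x j (k + 1))
    (T : ℕ) (hT : ∀ t < T, ∃ j ∈ A, ∃ k < L j, s j + k * m = t) (hs : ∀ j ∈ A, s j < T)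
    (hTm : T ≤ m) :
    ∑ j ∈ A, (L j : ℝ) * (s j + m * L j) ≤
      (1 + √2) / 2 * ∑ j ∈ A, (L j : ℝ) * (x j (L j - 1) + m) := by
  classical
  have hr2 : √2 * √2 = 2 := Real.mul_self_sqrt (by norm_num)
  have hr0 : 1 < √2 := by rw [Real.lt_sqrt (by norm_num)]; norm_num
  generalize √2 = r at *
  have hsinj : Set.InjOn s A := fun j hj j' hj' h =>
    (hinj j hj j' hj' 0 (hL j hj) 0 (hL j' hj') (by simpa using h)).1
  have hx0inj : Set.InjOn (fun j => x j 0) A := fun j hj j' hj' h =>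
    (hxinj j hj j' hj' 0 (hL j hj) 0 (hL j' hj') h).1
  -- A loop other than the first of its job lies in a slot `≥ m ≥ T`, so the slots before `T` are
  -- exactly the starts of the jobs.
  have himg : A.image s = Finset.range T := by
    ext t
    simp only [Finset.mem_image, Finset.mem_range]
    constructor
    · rintro ⟨j, hj, rfl⟩; exact hs j hj
    · intro ht
      obtain ⟨j, hj, k, hk, h⟩ := hT t ht
      rcases Nat.eq_zero_or_pos k with rfl | hk0
      · exact ⟨j, hj, by simpa using h⟩
      · have : m ≤ k * m := Nat.le_mul_of_pos_left m hk0
        omega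
  have hcard : A.card = T := by
    rw [← Finset.card_image_of_injOn hsinj, himg, Finset.card_range]
  have hsum : ∑ j ∈ A, (s j : ℝ) = T * (T - 1) / 2 := by
    rw [← Finset.sum_image (f := fun a : ℕ => (a : ℝ)) hsinj, himg]
    have := sum_range_arith 0 1 T
    simp only [zero_add, mul_one] at this
    rw [this]; ring
  have hsx : ∑ j ∈ A, (s j : ℝ) ≤ ∑ j ∈ A, (x j 0 : ℝ) := by
    rcases Nat.eq_zero_or_pos T with h0 | hTpos
    · have : A = ∅ := by rw [← Finset.card_eq_zero, hcard, h0]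
      simp [this]
    · have hT1 : (1 : ℝ) ≤ T := by exact_mod_cast hTpos
      have h := le_sum_of_injOn A (fun j => x j 0) hx0inj (T - 1 / 2) (by linarith)
      have h' : 0 ≤ ∑ j ∈ A, max ((x j 0 : ℝ) - (T - 1 / 2)) 0 :=
        Finset.sum_nonneg fun _ _ => le_max_right _ _
      rw [hcard] at h
      rw [hsum]
      nlinarith
  -- The correction `ρ * (s j - x j 0)` is harmless: its sum is at most 0, since the starts `s j`
  -- are `0, …, T - 1`.
  have hjob : ∀ j ∈ A, (L j : ℝ) * (s j + m * L j) ≤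
      (1 + r) / 2 * (L j * (x j (L j - 1) + m)) + (1 + r) / 2 * (s j - x j 0) := by
    intro j hj
    have hLj : (1 : ℝ) ≤ L j := by exact_mod_cast hL j hj
    have hsm : (s j : ℝ) ≤ m := by exact_mod_cast (hs j hj).le.trans hTm
    have hm' : (0 : ℝ) < m := by exact_mod_cast hm
    have hx : (x j 0 : ℝ) + (L j - 1) * m ≤ x j (L j - 1) := by
      have := add_mul_le_of_step (hstep j hj) 0 (L j - 1) (by have := hL j hj; omega)
      rw [zero_add] at this
      have h2 : (x j 0 : ℝ) + ((L j - 1 : ℕ) : ℝ) * m ≤ x j (L j - 1) := by exact_mod_cast this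
      rwa [Nat.cast_sub (hL j hj), Nat.cast_one] at h2
    have h1 : (L j : ℝ) * (x j 0 + m * L j) ≤ L j * (x j (L j - 1) + m) :=
      mul_le_mul_of_nonneg_left (by linarith) (by linarith)
    have h2 : (x j 0 : ℝ) ≤ L j * x j 0 := by
      nlinarith [(Nat.cast_nonneg (x j 0) : (0 : ℝ) ≤ _)]
    have h3 : (L j : ℝ) * s j ≤ ((1 + r) / 2 - 1) * (m * L j * L j) + (1 + r) / 2 * s j := by
      have hp : 0 ≤ (r - 1) / 2 * (m * L j - (1 + r) * s j) ^ 2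
          + (1 + r) / 2 * (s j * (m - s j)) := by
        have h4 : 0 ≤ (m : ℝ) - s j := by linarith
        have h5 : 0 ≤ r - 1 := by linarith
        positivity
      have e : (m : ℝ) * (((1 + r) / 2 - 1) * (m * L j * L j) + (1 + r) / 2 * s j - L j * s j)
          = (r - 1) / 2 * (m * L j - (1 + r) * s j) ^ 2 + (1 + r) / 2 * (s j * (m - s j)) := by
        linear_combination (m * L j * s j - (1 + r) / 2 * s j ^ 2 : ℝ) * hr2
      rw [← e] at hp
      linarith [nonneg_of_mul_nonneg_right hp hm']
    have hr' : (0 : ℝ) ≤ (1 + r) / 2 := by linarith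
    nlinarith [mul_le_mul_of_nonneg_left h1 hr', mul_le_mul_of_nonneg_left h2 hr']
  refine (Finset.sum_le_sum hjob).trans ?_
  rw [Finset.sum_add_distrib, ← Finset.mul_sum, ← Finset.mul_sum, Finset.sum_sub_distrib]
  have : (1 + r) / 2 * (∑ j ∈ A, (s j : ℝ) - ∑ j ∈ A, (x j 0 : ℝ)) ≤ 0 :=
    mul_nonpos_of_nonneg_of_nonpos (by linarith) (by linarith)
  linarith

/-- A list schedule in which every machine is used. -/
theorem list_schedule_bound_of_ge (hm : 0 < m) (hL : ∀ j ∈ A, 0 < L j)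
    (hinj : ∀ j ∈ A, ∀ j' ∈ A, ∀ k < L j, ∀ k' < L j', s j + k * m = s j' + k' * m →
      j = j' ∧ k = k')
    (hxinj : ∀ j ∈ A, ∀ j' ∈ A, ∀ k < L j, ∀ k' < L j', x j k = x j' k' → j = j' ∧ k = k')
    (hstep : ∀ j ∈ A, ∀ k, k + 1 < L j → x j k + m ≤ x j (k + 1))
    (T : ℕ) (hT : ∀ t < T, ∃ j ∈ A, ∃ k < L j, s j + k * m = t)
    (hT' : ∀ j ∈ A, ∀ k < L j, s j + k * m ≠ T) (hs : ∀ j ∈ A, s j < T)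
    (hTm : m ≤ T) :
    ∑ j ∈ A, (L j : ℝ) * (s j + m * L j) ≤
      (1 + √2) / 2 * ∑ j ∈ A, (L j : ℝ) * (x j (L j - 1) + m) := by
  classical
  have hex : ∀ j, ∃ b, j ∈ A → 1 ≤ b ∧ b ≤ L j ∧ (∀ k < b, s j + k * m < T) ∧
      (b < L j → T ≤ s j + b * m) := by
    intro j
    by_cases hj : j ∈ A
    · obtain ⟨b, hb⟩ := exists_loops_before (m := m) (s j) (L j) T (hL j hj) (hs j hj)
      exact ⟨b, fun _ => hb⟩
    · exact ⟨0, fun h => absurd h hj⟩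
  choose b hb using hex
  obtain ⟨c, hc⟩ : ∃ c : ι → ℕ, ∀ j, c j = L j - b j := ⟨_, fun _ => rfl⟩
  have hLbc : ∀ j ∈ A, L j = b j + c j := fun j hj => by
    have := (hb j hj).2.1; have := hc j; omega
  -- the slots before `T`
  have hslot : Set.InjOn (fun p : Σ _ : ι, ℕ => s p.1 + p.2 * m)
      (A.sigma fun j => Finset.range (b j) : Finset (Σ _ : ι, ℕ)) := by
    rintro ⟨j, k⟩ hp ⟨j', k'⟩ hp' h
    simp only [Finset.coe_sigma, Set.mem_sigma_iff, Finset.mem_coe, Finset.mem_range] at hp hp'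
    obtain ⟨h1, h2⟩ := hinj j hp.1 j' hp'.1 k (hp.2.trans_le (hb j hp.1).2.1) k'
      (hp'.2.trans_le (hb j' hp'.1).2.1) h
    subst h1; subst h2; rfl
  have himg : (A.sigma fun j => Finset.range (b j)).image
      (fun p : Σ _ : ι, ℕ => s p.1 + p.2 * m) = Finset.range T := by
    ext t
    simp only [Finset.mem_image, Finset.mem_sigma, Finset.mem_range, Sigma.exists]
    constructor
    · rintro ⟨j, k, ⟨hj, hk⟩, rfl⟩; exact (hb j hj).2.2.1 k hk
    · intro ht
      obtain ⟨j, hj, k, hk, h⟩ := hT t ht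
      refine ⟨j, k, ⟨hj, ?_⟩, h⟩
      by_contra hkb
      have h1 := (hb j hj).2.2.2 (by omega)
      have h2 : b j * m ≤ k * m := Nat.mul_le_mul_right m (by omega)
      omega
  have hbT : ∑ j ∈ A, (b j : ℝ) = T := by
    have h := congrArg Finset.card himg
    rw [Finset.card_image_of_injOn hslot, Finset.card_sigma, Finset.card_range] at h
    simp only [Finset.card_range] at h
    exact_mod_cast h
  have hsumT : ∑ j ∈ A, ∑ k ∈ Finset.range (b j), ((s j : ℝ) + k * m) = T * (T - 1) / 2 := by
    have h1 := Finset.sum_image (f := fun a : ℕ => (a : ℝ)) hslot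
    rw [himg, Finset.sum_sigma] at h1
    have h2 := sum_range_arith 0 1 T
    simp only [zero_add, mul_one] at h2
    rw [h2] at h1
    push_cast at h1
    rw [← h1]; ring
  -- the jobs that run beyond `T`
  have hover : ∀ j ∈ A, 0 < c j → T < s j + b j * m ∧ s j + b j * m < T + m := by
    intro j hj hcj
    have hlt : b j < L j := by have := hLbc j hj; omega
    have h1 := (hb j hj).2.2.2 hlt
    have h2 := hT' j hj (b j) hlt
    have h3 := (hb j hj).2.2.1 (b j - 1) (by have := (hb j hj).1; omega)
    obtain ⟨b', hb'⟩ : ∃ b', b j = b' + 1 := ⟨b j - 1, by have := (hb j hj).1; omega⟩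
    rw [hb'] at h1 h2 h3 ⊢
    rw [Nat.add_sub_cancel] at h3
    rw [Nat.succ_mul] at *
    omega
  -- The first loops after `T` of the overhanging jobs lie in distinct slots strictly between `T`
  -- and `T + m`, because `T` itself is idle.
  have hKcard : (A.filter fun j => 0 < c j).card + 1 ≤ m := by
    have h : (A.filter fun j => 0 < c j).card ≤ (Finset.Ioo T (T + m)).card := by
      apply Finset.card_le_card_of_injOn (fun j => s j + b j * m)
      · intro j hj
        simp only [Finset.coe_filter, Set.mem_ofPred_eq] at hj
        simpa using hover j hj.1 hj.2
      · intro j hj j' hj' h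
        simp only [Finset.coe_filter, Set.mem_ofPred_eq] at hj hj'
        exact (hinj j hj.1 j' hj'.1 _ (by have := hLbc j hj.1; omega) _
          (by have := hLbc j' hj'.1; omega) h).1
    rw [Nat.card_Ioo] at h
    omega
  have hr2 : √2 * √2 = 2 := Real.mul_self_sqrt (by norm_num)
  have hr0 : 1 < √2 := by rw [Real.lt_sqrt (by norm_num)]; norm_num
  have hm1 : (1 : ℝ) ≤ m := by exact_mod_cast hm
  have hmT : (m : ℝ) ≤ T := by exact_mod_cast hTm
  -- With this threshold `h`, `ρ * (2 * h * T - (h + 1/2)²) = T² - ρ * T`, which matches twice the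
  -- slot sum `T * (T - 1)` of the list schedule to leading order.
  have hh : 0 ≤ √2 * T - 1 / 2 := by nlinarith
  -- Loop `k` of any slotting is in a slot `≥ k * m`; `G j` is twice the excess over the threshold
  -- that this forces.
  obtain ⟨G, hG⟩ : ∃ G : ι → ℝ, ∀ j, G j = 2 * ∑ k ∈ Finset.range (L j),
      max ((k : ℝ) * m - (√2 * T - 1 / 2)) 0 := ⟨_, fun _ => rfl⟩
  have hG0 : ∀ j, 0 ≤ G j := fun j => by
    rw [hG]; exact mul_nonneg (by norm_num) (Finset.sum_nonneg fun _ _ => le_max_right _ _)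
  -- upper bound for the list schedule
  have hupper : 2 * ∑ j ∈ A, (L j : ℝ) * (s j + m * L j) ≤ T * (T - 1) +
      ∑ j ∈ A, (2 * c j * (T + m - 1) + m * c j * (c j - 1) : ℝ) +
      ∑ j ∈ A, (m * L j * (L j + 1) : ℝ) := by
    have h1 : (T : ℝ) * (T - 1) =
        ∑ j ∈ A, 2 * ∑ k ∈ Finset.range (b j), ((s j : ℝ) + k * m) := by
      rw [← Finset.mul_sum, hsumT]; ring
    rw [h1, Finset.mul_sum, ← Finset.sum_add_distrib, ← Finset.sum_add_distrib]
    apply Finset.sum_le_sum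
    intro j hj
    rw [sum_range_arith, hLbc j hj]
    push_cast
    rcases Nat.eq_zero_or_pos (c j) with h0 | hpos
    · rw [h0]; push_cast; nlinarith
    · have h2 : ((s j : ℝ) + b j * m) ≤ T + m - 1 := by
        have : s j + b j * m + 1 ≤ T + m := (hover j hj hpos).2
        have : ((s j : ℝ) + b j * m + 1) ≤ T + m := by exact_mod_cast this
        linarith
      nlinarith [mul_le_mul_of_nonneg_left h2 (Nat.cast_nonneg (c j) : (0 : ℝ) ≤ c j)]
  -- lower bound for the competing schedule
  have hlower : 2 * (√2 * T - 1 / 2) * ∑ j ∈ A, (b j + c j : ℝ) - (√2 * T) ^ 2 + ∑ j ∈ A, G j +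
      ∑ j ∈ A, (m * L j * (L j + 1) : ℝ) ≤ 2 * ∑ j ∈ A, (L j : ℝ) * (x j (L j - 1) + m) := by
    have hxi : Set.InjOn (fun p : Σ _ : ι, ℕ => x p.1 p.2)
        (A.sigma fun j => Finset.range (L j) : Finset (Σ _ : ι, ℕ)) := by
      rintro ⟨j, k⟩ hp ⟨j', k'⟩ hp' h
      simp only [Finset.coe_sigma, Set.mem_sigma_iff, Finset.mem_coe, Finset.mem_range] at hp hp'
      obtain ⟨h1, h2⟩ := hxinj j hp.1 j' hp'.1 k hp.2 k' hp'.2 h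
      subst h1; subst h2; rfl
    have h1 := le_sum_of_injOn _ _ hxi _ hh
    rw [Finset.sum_sigma, Finset.sum_sigma, Finset.card_sigma] at h1
    simp only [Finset.card_range] at h1
    have h2 : ∑ j ∈ A, G j ≤ 2 * ∑ j ∈ A, ∑ k ∈ Finset.range (L j),
        max ((x j k : ℝ) - (√2 * T - 1 / 2)) 0 := by
      rw [Finset.mul_sum]
      apply Finset.sum_le_sum
      intro j hj
      rw [hG]
      apply mul_le_mul_of_nonneg_left _ (by norm_num)
      apply Finset.sum_le_sum
      intro k hk
      apply max_le_max_right
      have := add_mul_le_of_step (hstep j hj) 0 k (by simpa using hk)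
      rw [zero_add] at this
      have h3 : (k : ℝ) * m ≤ x j k := by exact_mod_cast (Nat.le_add_left _ _).trans this
      linarith
    have h3 : 2 * ∑ j ∈ A, ∑ k ∈ Finset.range (L j), (x j k : ℝ) +
        ∑ j ∈ A, (m * L j * (L j + 1) : ℝ) ≤ 2 * ∑ j ∈ A, (L j : ℝ) * (x j (L j - 1) + m) := by
      rw [Finset.mul_sum, Finset.mul_sum, ← Finset.sum_add_distrib]
      exact Finset.sum_le_sum fun j hj => sum_slots_le_mul_completion (hstep j hj)
    have h4 : ∑ j ∈ A, (b j + c j : ℝ) = ((∑ j ∈ A, L j : ℕ) : ℝ) := by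
      push_cast
      exact Finset.sum_congr rfl fun j hj => by rw [hLbc j hj]; push_cast; ring
    rw [h4]
    nlinarith
  -- comparison job by job
  have hjob : ∀ j ∈ A, (2 * c j * (T + m - 1) + m * c j * (c j - 1) : ℝ)
      - ((1 + √2) / 2 - 1) * (m * L j * (L j + 1) - 2 * m * b j) ≤
      (1 + √2) / 2 * (2 * (√2 * T - 1 / 2) * c j + G j) +
        if 0 < c j then 2 * ((1 + √2) / 2 - 1) * (T : ℝ) else 0 := by
    intro j hj
    have hb1 : (1 : ℝ) ≤ b j := by exact_mod_cast (hb j hj).1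
    rcases Nat.eq_zero_or_pos (c j) with h0 | hpos
    · rw [hLbc j hj, h0]
      simp only [lt_irrefl, if_false]
      push_cast
      have h1 : 0 ≤ ((1 + √2) / 2 - 1) * (m * (b j * (b j - 1)) : ℝ) :=
        mul_nonneg (by linarith) (mul_nonneg (by linarith) (mul_nonneg (by linarith)
          (by linarith)))
      have h2 : 0 ≤ (1 + √2) / 2 * G j := mul_nonneg (by linarith) (hG0 j)
      nlinarith
    · rw [if_pos hpos]
      have hm2 : (2 : ℝ) ≤ m := by
        have := hover j hj hpos
        have : 2 ≤ m := by omega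
        exact_mod_cast this
      have h := overhanging_job_bound m T (b j) (c j) (G j) hm2 hmT hb1 (Nat.cast_nonneg _)
        (hG0 j) (by
          intro hle
          have hcast : ((b j : ℝ) + c j) = L j := by rw [hLbc j hj]; push_cast; ring
          rw [hcast] at hle ⊢
          have := le_sum_arith_pos_part m _ (by linarith) hh (L j) hle
          rw [hG]
          linarith)
      rw [hLbc j hj]
      push_cast
      exact h
  have hsum := Finset.sum_le_sum hjob
  simp only [Finset.sum_add_distrib, Finset.sum_sub_distrib, ← Finset.mul_sum] at hsum hlower
  rw [← Finset.sum_filter, Finset.sum_const, nsmul_eq_mul] at hsum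
  rw [hbT] at hsum hlower
  have hK : ((A.filter fun j => 0 < c j).card : ℝ) + 1 ≤ m := by exact_mod_cast hKcard
  -- The terms `2 * m * b j` in `hjob` add up to a reserve `(√2 - 1) * T * m`. It pays `(√2 - 1) *
  -- T` for each of at most `m - 1` overhanging jobs, and the share left over absorbs the terms
  -- linear in `T`.
  have hK' : (√2 - 1) * T * (((A.filter fun j => 0 < c j).card : ℝ) + 1) ≤ (√2 - 1) * T * m :=
    mul_le_mul_of_nonneg_left hK (mul_nonneg (by linarith) (by linarith))
  have hρ := mul_le_mul_of_nonneg_left hlower (show 0 ≤ (1 + √2) / 2 by linarith)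
  have hT0 : (0 : ℝ) ≤ (√2 - 1) * T := mul_nonneg (by linarith) (by linarith)
  have hid : (1 + √2) / 2 * (2 * (√2 * T - 1 / 2) * T - (√2 * T) ^ 2) =
      (T : ℝ) ^ 2 - (1 + √2) / 2 * T := by
    linear_combination (T ^ 2 / 2 - √2 * T ^ 2 / 2 : ℝ) * hr2
  simp only [Finset.sum_add_distrib] at hupper
  nlinarith

/-- List scheduling of jobs whose weights are proportional to their numbers of loops. -/
theorem list_schedule_bound (hm : 0 < m) (hL : ∀ j ∈ A, 0 < L j)
    (hinj : ∀ j ∈ A, ∀ j' ∈ A, ∀ k < L j, ∀ k' < L j', s j + k * m = s j' + k' * m →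
      j = j' ∧ k = k')
    (hfill : ∀ j ∈ A, ∀ t < s j, ∃ j' ∈ A, ∃ k < L j', s j' + k * m = t)
    (hxinj : ∀ j ∈ A, ∀ j' ∈ A, ∀ k < L j, ∀ k' < L j', x j k = x j' k' → j = j' ∧ k = k')
    (hstep : ∀ j ∈ A, ∀ k, k + 1 < L j → x j k + m ≤ x j (k + 1)) :
    ∑ j ∈ A, (L j : ℝ) * (s j + m * L j) ≤
      (1 + √2) / 2 * ∑ j ∈ A, (L j : ℝ) * (x j (L j - 1) + m) := by
  classical
  have hidle := exists_idle_slot A m L s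
  have hT : ∀ t < Nat.find hidle, ∃ j ∈ A, ∃ k < L j, s j + k * m = t := fun t ht =>
    not_not.1 (Nat.find_min hidle ht)
  have hT' : ∀ j ∈ A, ∀ k < L j, s j + k * m ≠ Nat.find hidle := fun j hj k hk h =>
    Nat.find_spec hidle ⟨j, hj, k, hk, h⟩
  -- All slots before the start of a job are occupied, so no job starts after the first idle slot.
  have hs : ∀ j ∈ A, s j < Nat.find hidle := by
    intro j hj
    by_contra hcon
    rcases (not_lt.1 hcon).lt_or_eq with h | h
    · exact Nat.find_spec hidle (hfill j hj _ h)
    · exact hT' j hj 0 (hL j hj) (by rw [h]; simp)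
  rcases le_total (Nat.find hidle) m with h | h
  · exact list_schedule_bound_of_le A m L s x hm hL hinj hxinj hstep _ hT hs h
  · exact list_schedule_bound_of_ge A m L s x hm hL hinj hxinj hstep _ hT hT' hs h

end ListSchedule

/-! ### Abel summation over level sets. -/

/-- Abel summation: if all sums over upper level sets of `r` are nonnegative, then so is the sum
weighted by `r`. -/
theorem sum_mul_nonneg_of_level_sets {ι : Type*} (f : ι → ℝ) (A : Finset ι) :
    ∀ r : ι → ℝ, (∀ j ∈ A, 0 ≤ r j) → (∀ θ : ℝ, 0 ≤ ∑ j ∈ A with θ ≤ r j, f j) →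
      0 ≤ ∑ j ∈ A, r j * f j := by
  classical
  induction A using Finset.strongInduction with
  | H A ih =>
    intro r hr hf
    rcases A.eq_empty_or_nonempty with rfl | hne
    · simp
    -- Subtracting the least value `r a` leaves a sum over a smaller set, and `r a` times the sum of
    -- `f` over all of `A`, itself a level set.
    obtain ⟨a, ha, hmin⟩ := A.exists_min_image r hne
    have hsub : (A.filter fun j => r a < r j) ⊂ A :=
      Finset.filter_ssubset.2 ⟨a, ha, lt_irrefl _⟩
    have h1 := ih _ hsub (fun j => r j - r a)
      (fun j hj => by linarith [(Finset.mem_filter.1 hj).2]) (by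
        intro θ
        -- For `θ ≤ 0` the level set is everything that remains, which is the level set of `r` at
        -- its least remaining value.
        rcases le_or_gt θ 0 with hθ | hθ
        · rcases (A.filter fun j => r a < r j).eq_empty_or_nonempty with he | hne'
          · simp [he]
          obtain ⟨a', ha', hmin'⟩ := Finset.exists_min_image _ r hne'
          convert hf (r a') using 2
          ext j
          simp only [Finset.mem_filter] at ha' hmin' ⊢
          constructor
          · rintro ⟨⟨hj, h⟩, -⟩; exact ⟨hj, hmin' j ⟨hj, h⟩⟩
          · rintro ⟨hj, h⟩; exact ⟨⟨hj, by linarith⟩, by linarith⟩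
        · convert hf (θ + r a) using 2
          ext j
          simp only [Finset.mem_filter]
          constructor
          · rintro ⟨⟨hj, h⟩, h'⟩; exact ⟨hj, by linarith⟩
          · rintro ⟨hj, h⟩; exact ⟨⟨hj, by linarith⟩, by linarith⟩)
    have h2 : ∑ j ∈ A with r a < r j, (r j - r a) * f j = ∑ j ∈ A, (r j - r a) * f j := by
      apply Finset.sum_subset (Finset.filter_subset _ _)
      intro j hj hj'
      have : r j = r a := by
        have h3 := hmin j hj
        have h4 : ¬ r a < r j := fun h => hj' (Finset.mem_filter.2 ⟨hj, h⟩)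
        linarith
      rw [this]; ring
    have h3 : 0 ≤ ∑ j ∈ A, f j := by
      have := hf (r a)
      rwa [Finset.filter_true_of_mem hmin] at this
    have h4 : ∑ j ∈ A, r j * f j = r a * ∑ j ∈ A, f j + ∑ j ∈ A, (r j - r a) * f j := by
      rw [Finset.mul_sum, ← Finset.sum_add_distrib]
      exact Finset.sum_congr rfl fun j _ => by ring
    rw [h4]
    have := mul_nonneg (hr a ha) h3
    linarith

/-! ### Rounding to slots, and existence of an optimal permutation schedule. -/

namespace ReentrantShop

variable (I : ReentrantShop)

/-- An assignment of distinct time slots on the first machine to the loops, such that consecutive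
loops of a job are at least `m` slots apart. -/
structure IsSlotting (x : I.Loop → ℕ) : Prop where
  inj : Function.Injective x
  step : ∀ (j : Fin I.n) (k k' : Fin (I.loops j)), (k : ℕ) + 1 = k' →
    x ⟨j, k⟩ + I.m ≤ x ⟨j, k'⟩

/-- The schedule in which each loop starts in its slot and never waits. -/
def ofSlots (x : I.Loop → ℕ) : I.Schedule := fun i l => (x l : ℝ) + (i : ℕ)

variable {I}

theorem start_ofSlots (x : I.Loop → ℕ) (l : I.Loop) : I.start (I.ofSlots x) l = x l := by
  simp [start, ofSlots, firstMachine]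

theorem completion_ofSlots (x : I.Loop → ℕ) (l : I.Loop) :
    I.completion (I.ofSlots x) l = x l + I.m := by
  have := I.m_pos
  simp only [completion, ofSlots, lastMachine]
  rw [Nat.cast_sub this]
  push_cast; ring

theorem IsSlotting.isFeasible {x : I.Loop → ℕ} (hx : I.IsSlotting x) :
    I.IsFeasible (I.ofSlots x) where
  nonneg i l := by simp only [ofSlots]; positivity
  route i i' l h := by
    simp only [ofSlots]; rw [← h]; push_cast; linarith
  reentry j k k' h := by
    rw [completion_ofSlots, start_ofSlots]
    exact_mod_cast hx.step j k k' h
  capacity i l l' h := by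
    simp only [ofSlots]
    rcases lt_or_gt_of_ne (hx.inj.ne h) with h' | h'
    · left
      have : (x l : ℝ) + 1 ≤ x l' := by exact_mod_cast h'
      linarith
    · right
      have : (x l' : ℝ) + 1 ≤ x l := by exact_mod_cast h'
      linarith

theorem isPermutation_ofSlots (x : I.Loop → ℕ) : I.IsPermutation (I.ofSlots x) := by
  intro i i' l l' h
  simp only [ofSlots] at h ⊢
  linarith

theorem IsFeasible.start_add_le {σ : I.Schedule} (hσ : I.IsFeasible σ) (l : I.Loop) :
    I.start σ l + I.m ≤ I.completion σ l := by
  have h : ∀ i : ℕ, ∀ hi : i < I.m, I.start σ l + i ≤ σ ⟨i, hi⟩ l := by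
    intro i
    induction i with
    | zero => intro hi; simp [start, firstMachine]
    | succ i ih =>
      intro hi
      have h1 := ih (by omega)
      have h2 := hσ.route ⟨i, by omega⟩ ⟨i + 1, hi⟩ l rfl
      push_cast
      linarith
  have h1 := h (I.m - 1) (Nat.sub_lt I.m_pos Nat.one_pos)
  rw [Nat.cast_sub I.m_pos] at h1
  simp only [completion, lastMachine]
  push_cast at h1
  linarith

/-- Every feasible schedule can be rounded down to slots. -/
theorem IsFeasible.exists_slotting {τ : I.Schedule} (hτ : I.IsFeasible τ) :
    ∃ x : I.Loop → ℕ, I.IsSlotting x ∧ ∀ j, (x (I.lastLoop j) : ℝ) + I.m ≤ I.jobCompletion τ j := by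
  have h0 : ∀ l, 0 ≤ I.start τ l := fun l => hτ.nonneg _ l
  -- Taking floors preserves integral gaps: `d = 1` gives distinct slots, `d = m` the spacing of the
  -- loops of a job.
  have hfl : ∀ (a b : ℝ) (d : ℕ), 0 ≤ a → a + d ≤ b → ⌊a⌋₊ + d ≤ ⌊b⌋₊ := by
    intro a b d ha hab
    rw [← Nat.floor_add_natCast ha]
    exact Nat.floor_le_floor hab
  refine ⟨fun l => ⌊I.start τ l⌋₊, ⟨?_, ?_⟩, ?_⟩
  · intro l l' h
    by_contra hne
    simp only at h
    rcases hτ.capacity I.firstMachine l l' hne with h' | h'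
    · have := hfl (I.start τ l) (I.start τ l') 1 (h0 l) (by simpa [start] using h')
      omega
    · have := hfl (I.start τ l') (I.start τ l) 1 (h0 l') (by simpa [start] using h')
      omega
  · intro j k k' h
    exact hfl _ _ _ (h0 _) ((hτ.start_add_le _).trans (hτ.reentry j k k' h))
  · intro j
    have := hτ.start_add_le (I.lastLoop j)
    have := Nat.floor_le (h0 (I.lastLoop j))
    simp only [jobCompletion]
    linarith

theorem IsSlotting.mono {x : I.Loop → ℕ} (hx : I.IsSlotting x) (j : Fin I.n) (k : ℕ) :
    ∀ d (hk : k + d < I.loops j), x ⟨j, ⟨k, by omega⟩⟩ + d * I.m ≤ x ⟨j, ⟨k + d, hk⟩⟩ := by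
  intro d
  induction d with
  | zero => intro hk; simp
  | succ d ih =>
    intro hk
    have h1 := ih (by omega)
    have h2 := hx.step j ⟨k + d, by omega⟩ ⟨k + (d + 1), hk⟩ rfl
    rw [Nat.succ_mul]
    omega

theorem IsSlotting.le_lastLoop {x : I.Loop → ℕ} (hx : I.IsSlotting x) (l : I.Loop) :
    x l ≤ x (I.lastLoop l.1) := by
  obtain ⟨j, ⟨k, hk⟩⟩ := l
  have h := hx.mono j k (I.loops j - 1 - k) (by omega)
  have e : (⟨j, ⟨k + (I.loops j - 1 - k), by omega⟩⟩ : I.Loop) = I.lastLoop j := by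
    simp only [lastLoop]
    congr 2
    omega
  rw [e] at h
  exact (Nat.le_add_right _ _).trans h

theorem cost_ofSlots (x : I.Loop → ℕ) :
    I.cost (I.ofSlots x) = ∑ j, I.w j * ((x (I.lastLoop j) : ℝ) + I.m) := by
  simp only [cost, jobCompletion, completion_ofSlots]

theorem IsFeasible.exists_slotting_cost_le {τ : I.Schedule} (hτ : I.IsFeasible τ) :
    ∃ x : I.Loop → ℕ, I.IsSlotting x ∧ I.cost (I.ofSlots x) ≤ I.cost τ := by
  obtain ⟨x, hx, h⟩ := hτ.exists_slotting
  refine ⟨x, hx, ?_⟩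
  rw [cost_ofSlots]
  exact Finset.sum_le_sum fun j _ => mul_le_mul_of_nonneg_left (h j) (I.w_pos j).le

/-- As soon as there is a feasible schedule, some permutation schedule is optimal. -/
theorem exists_optimal_permutation {x₀ : I.Loop → ℕ} (hx₀ : I.IsSlotting x₀) :
    ∃ τ : I.Schedule, I.IsOptimal τ ∧ I.IsPermutation τ := by
  obtain ⟨B, hB⟩ : ∃ B : ℕ, ∀ j, I.cost (I.ofSlots x₀) / I.w j ≤ B := by
    refine ⟨Finset.univ.sup fun j => ⌈I.cost (I.ofSlots x₀) / I.w j⌉₊, fun j => ?_⟩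
    refine (Nat.le_ceil _).trans ?_
    exact_mod_cast Finset.le_sup (f := fun j => ⌈I.cost (I.ofSlots x₀) / I.w j⌉₊)
      (Finset.mem_univ j)
  -- As weights are positive, a bound on the cost bounds each last slot, hence all slots.
  have hfin : {x : I.Loop → ℕ | I.IsSlotting x ∧
      I.cost (I.ofSlots x) ≤ I.cost (I.ofSlots x₀)}.Finite := by
    apply (Set.finite_Iic (fun _ : I.Loop => B)).subset
    rintro x ⟨hx, hc⟩ l
    have h1 : I.w l.1 * ((x (I.lastLoop l.1) : ℝ) + I.m) ≤ I.cost (I.ofSlots x) := by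
      rw [cost_ofSlots]
      exact Finset.single_le_sum (f := fun j => I.w j * ((x (I.lastLoop j) : ℝ) + I.m))
        (fun j _ => mul_nonneg (I.w_pos j).le (by positivity)) (Finset.mem_univ l.1)
    have hw := I.w_pos l.1
    have h2 : (x (I.lastLoop l.1) : ℝ) + I.m ≤ B := by
      refine le_trans ?_ (hB l.1)
      rw [le_div_iff₀ hw]
      linarith
    have h3 : (x l : ℝ) ≤ x (I.lastLoop l.1) := by exact_mod_cast hx.le_lastLoop l
    have h4 : (x l : ℝ) ≤ B := by linarith [(Nat.cast_nonneg I.m : (0 : ℝ) ≤ _)]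
    exact_mod_cast h4
  obtain ⟨x, ⟨hx, hxc⟩, hmin⟩ := Set.exists_min_image _ (fun x => I.cost (I.ofSlots x)) hfin
    ⟨x₀, hx₀, le_rfl⟩
  refine ⟨I.ofSlots x, ⟨hx.isFeasible, fun τ hτ => ?_⟩, isPermutation_ofSlots x⟩
  obtain ⟨y, hy, hyc⟩ := hτ.exists_slotting_cost_le
  rcases le_total (I.cost (I.ofSlots y)) (I.cost (I.ofSlots x₀)) with h | h
  · exact (hmin y ⟨hy, h⟩).trans hyc
  · exact hxc.trans (h.trans hyc)

theorem IsFeasible.cost_pos {τ : I.Schedule} (hτ : I.IsFeasible τ) : 0 < I.cost τ := by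
  have : Nonempty (Fin I.n) := ⟨⟨0, I.n_pos⟩⟩
  apply Finset.sum_pos _ Finset.univ_nonempty
  intro j _
  have := hτ.nonneg I.lastMachine (I.lastLoop j)
  exact mul_pos (I.w_pos j) (by simp only [jobCompletion, completion]; linarith)

/-! ### List schedules exist and obey the WLRL rule. -/

/-- Weight of a job over its number of loops. -/
noncomputable def ratio (I : ReentrantShop) (j : Fin I.n) : ℝ := I.w j / (I.loops j : ℝ)

/-- Job `j` occupies the slots `s j`, `s j + m`, …, and every slot before `s j` is taken by a job
whose ratio is at least as large. -/
structure IsListSchedule (I : ReentrantShop) (A : Finset (Fin I.n)) (s : Fin I.n → ℕ) : Prop where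
  inj : ∀ j ∈ A, ∀ j' ∈ A, ∀ k < I.loops j, ∀ k' < I.loops j',
    s j + k * I.m = s j' + k' * I.m → j = j' ∧ k = k'
  filled : ∀ j ∈ A, ∀ t < s j, ∃ j' ∈ A, ∃ k' < I.loops j',
    s j' + k' * I.m = t ∧ I.ratio j ≤ I.ratio j'

/-- Jobs are inserted by nonincreasing ratio, each at the first idle slot `T`. The slots `T + k' *
m` are then free too: an earlier job occupying one of them would either also occupy `T`, by going
back `k'` loops, or start after `T`, although everything before its start is filled. -/
theorem exists_listSchedule (I : ReentrantShop) (A : Finset (Fin I.n)) :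
    ∃ s, I.IsListSchedule A s := by
  classical
  induction A using Finset.induction_on_max_value (fun j => - I.ratio j) with
  | empty => exact ⟨0, by simp, by simp⟩
  | insert a A haA hmax ih =>
    obtain ⟨s, hs⟩ := ih
    have hidle := exists_idle_slot A I.m I.loops s
    obtain ⟨T, hTdef⟩ : ∃ T, T = Nat.find hidle := ⟨_, rfl⟩
    have hT : ∀ t < T, ∃ j ∈ A, ∃ k < I.loops j, s j + k * I.m = t := fun t ht =>
      not_not.1 (Nat.find_min hidle (hTdef ▸ ht))
    have hT' : ∀ j ∈ A, ∀ k < I.loops j, s j + k * I.m ≠ T := fun j hj k hk h =>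
      Nat.find_spec hidle ⟨j, hj, k, hk, h.trans hTdef⟩
    have hdisj : ∀ j ∈ A, ∀ k < I.loops j, ∀ k', s j + k * I.m ≠ T + k' * I.m := by
      intro j hj k hk k' h
      rcases le_or_gt k' k with hkk | hkk
      · obtain ⟨d, rfl⟩ := Nat.exists_eq_add_of_le hkk
        apply hT' j hj d (by omega)
        rw [Nat.add_mul] at h
        omega
      · obtain ⟨d, rfl⟩ := Nat.exists_eq_add_of_lt hkk
        have hlt : T < s j := by
          have hm := I.m_pos
          have : (k + d + 1) * I.m = k * I.m + d * I.m + I.m := by ring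
          rw [this] at h
          have := Nat.zero_le (d * I.m)
          omega
        obtain ⟨j', hj', k'', hk'', h', -⟩ := hs.filled j hj T hlt
        exact hT' j' hj' k'' hk'' h'
    have hne : ∀ j ∈ A, j ≠ a := fun j hj h => haA (h ▸ hj)
    have hup : ∀ j ∈ A, Function.update s a T j = s j := fun j hj => by
      rw [Function.update_of_ne (hne j hj)]
    refine ⟨Function.update s a T, ?_, ?_⟩
    · intro j hj j' hj' k hk k' hk' h
      rcases Finset.mem_insert.1 hj with rfl | hjA <;> rcases Finset.mem_insert.1 hj' with rfl | hjA'
      · refine ⟨rfl, ?_⟩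
        have := Nat.add_left_cancel h
        exact Nat.eq_of_mul_eq_mul_right I.m_pos this
      · rw [hup j' hjA', Function.update_self] at h
        exact absurd h.symm (hdisj j' hjA' k' hk' k)
      · rw [hup j hjA, Function.update_self] at h
        exact absurd h (hdisj j hjA k hk k')
      · rw [hup j hjA, hup j' hjA'] at h
        exact hs.inj j hjA j' hjA' k hk k' hk' h
    · intro j hj t ht
      rcases Finset.mem_insert.1 hj with rfl | hj
      · rw [Function.update_self] at ht
        obtain ⟨j', hj', k, hk, h⟩ := hT t ht
        exact ⟨j', Finset.mem_insert_of_mem hj', k, hk, by rw [hup j' hj']; exact h,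
          by linarith [hmax j' hj']⟩
      · rw [hup j hj] at ht
        obtain ⟨j', hj', k, hk, h, hr⟩ := hs.filled j hj t ht
        exact ⟨j', Finset.mem_insert_of_mem hj', k, hk, by rw [hup j' hj']; exact h, hr⟩

/-- The slots of a list schedule. -/
def listSlots (I : ReentrantShop) (s : Fin I.n → ℕ) : I.Loop → ℕ := fun l => s l.1 + l.2 * I.m

theorem IsListSchedule.isSlotting {s : Fin I.n → ℕ} (hs : I.IsListSchedule Finset.univ s) :
    I.IsSlotting (I.listSlots s) where
  inj := by
    rintro ⟨j, k⟩ ⟨j', k'⟩ h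
    obtain ⟨h1, h2⟩ := hs.inj j (Finset.mem_univ _) j' (Finset.mem_univ _) k k.2 k' k'.2 h
    subst h1
    rw [Fin.ext h2]
  step j k k' h := by
    simp only [listSlots]
    rw [← h, Nat.succ_mul]
    omega

theorem loops_sub_pos (l : I.Loop) : (0 : ℝ) < (I.loops l.1 : ℝ) - (l.2 : ℕ) := by
  have : ((l.2 : ℕ) : ℝ) < I.loops l.1 := by exact_mod_cast l.2.2
  linarith

theorem ratio_le_remainingRatio (l : I.Loop) : I.ratio l.1 ≤ I.remainingRatio l := by
  apply div_le_div_of_nonneg_left (I.w_pos _).le (loops_sub_pos l)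
  linarith [(Nat.cast_nonneg (l.2 : ℕ) : (0 : ℝ) ≤ _)]

theorem ratio_lt_remainingRatio (l : I.Loop) (hl : 0 < (l.2 : ℕ)) :
    I.ratio l.1 < I.remainingRatio l := by
  apply div_lt_div_of_pos_left (I.w_pos _) (loops_sub_pos l)
  have : (0 : ℝ) < (l.2 : ℕ) := by exact_mod_cast hl
  linarith

theorem remainingRatio_of_first (l : I.Loop) (hl : (l.2 : ℕ) = 0) :
    I.remainingRatio l = I.ratio l.1 := by
  simp [remainingRatio, ratio, hl]

/-- Both variants of the rule enter the proof only through this and the next three facts, all in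
terms of `ratio`. -/
theorem not_precedes_self (v : WLRLVariant) (l : I.Loop) : ¬ I.Precedes v l l := by
  cases v
  · exact lt_irrefl _
  · rintro (h | ⟨-, h1, h2⟩)
    · exact lt_irrefl _ h
    · omega

theorem not_precedes_of_first (v : WLRLVariant) (l' l : I.Loop) (hl' : (l'.2 : ℕ) = 0)
    (h : I.ratio l'.1 ≤ I.ratio l.1) : ¬ I.Precedes v l' l := by
  cases v
  · simp only [Precedes, not_lt]
    rw [remainingRatio_of_first l' hl']
    exact h.trans (ratio_le_remainingRatio l)
  · rintro (h' | ⟨-, -, h2⟩)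
    · exact absurd h (not_le.2 h')
    · omega

theorem ratio_le_of_not_precedes (v : WLRLVariant) (l' l : I.Loop) (hl' : (l'.2 : ℕ) = 0)
    (hl : (l.2 : ℕ) = 0) (h : ¬ I.Precedes v l' l) : I.ratio l'.1 ≤ I.ratio l.1 := by
  cases v
  · simp only [Precedes, not_lt] at h
    rwa [remainingRatio_of_first l' hl', remainingRatio_of_first l hl] at h
  · exact not_lt.1 fun h' => h (Or.inl h')

/-- Starting a job strictly raises its remaining ratio; in the other variant the tie-breaking has
the same effect. This is what keeps a started job from being interrupted. -/
theorem precedes_of_started (v : WLRLVariant) (l' l : I.Loop) (hl' : 0 < (l'.2 : ℕ))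
    (hl : (l.2 : ℕ) = 0) (h : I.ratio l.1 ≤ I.ratio l'.1) : I.Precedes v l' l := by
  cases v
  · simp only [Precedes]
    rw [remainingRatio_of_first l hl]
    exact h.trans_lt (ratio_lt_remainingRatio l' hl')
  · rcases h.lt_or_eq with h | h
    · exact Or.inl h
    · exact Or.inr ⟨h, hl, hl'⟩

/-- The preceding loop is completed exactly when `l` starts, so a later loop never waits. -/
theorem IsListSchedule.start_eq_of_isAvailable {s : Fin I.n → ℕ} (l : I.Loop) (t : ℝ)
    (hl : 0 < (l.2 : ℕ)) (h : I.IsAvailable (I.ofSlots (I.listSlots s)) l t) :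
    (I.listSlots s l : ℝ) = t := by
  apply le_antisymm _ (by simpa [start_ofSlots] using h.1)
  obtain ⟨j, ⟨k, hk⟩⟩ := l
  simp only at hl
  have h2 := h.2 ⟨k - 1, by simp only; omega⟩ (by rw [Fin.lt_def]; simp only; omega)
  rw [completion_ofSlots] at h2
  refine le_trans (le_of_eq ?_) h2
  obtain ⟨k', rfl⟩ : ∃ k', k = k' + 1 := ⟨k - 1, by omega⟩
  simp only [listSlots, Nat.add_sub_cancel]
  push_cast; ring

/-- Only first loops ever wait, and while one waits, every slot is held by a job of at least its
ratio. -/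
theorem IsListSchedule.isWLRL (v : WLRLVariant) {s : Fin I.n → ℕ}
    (hs : I.IsListSchedule Finset.univ s) : I.IsWLRL v (I.ofSlots (I.listSlots s)) where
  feasible := hs.isSlotting.isFeasible
  no_wait i l := by rw [start_ofSlots]; rfl
  busy t l ht h := by
    simp only [start_ofSlots]
    have h1 := h.1
    rw [start_ofSlots] at h1
    rcases Nat.eq_zero_or_pos (l.2 : ℕ) with h0 | h0
    · have hle : ⌊t⌋₊ ≤ s l.1 := by
        rw [← Nat.floor_natCast (R := ℝ) (s l.1)]
        apply Nat.floor_le_floor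
        simpa [listSlots, h0] using h1
      rcases hle.lt_or_eq with hlt | heq
      · obtain ⟨j', -, k', hk', h', -⟩ := hs.filled l.1 (Finset.mem_univ _) _ hlt
        refine ⟨⟨j', ⟨k', hk'⟩⟩, ?_⟩
        simp only [listSlots]
        rw [h']
        exact ⟨Nat.floor_le ht, Nat.lt_floor_add_one t⟩
      · refine ⟨l, ?_⟩
        simp only [listSlots, h0, zero_mul, add_zero]
        rw [← heq]
        exact ⟨Nat.floor_le ht, Nat.lt_floor_add_one t⟩
    · exact ⟨l, by rw [IsListSchedule.start_eq_of_isAvailable l t h0 h]; simp⟩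
  select l l' h := by
    by_cases hll : l' = l
    · rw [hll]; exact not_precedes_self v l
    have hne : I.listSlots s l ≠ I.listSlots s l' := fun e => hll (hs.isSlotting.inj e).symm
    have h1 := h.1
    rw [start_ofSlots, start_ofSlots] at h1
    have h1 : I.listSlots s l < I.listSlots s l' :=
      lt_of_le_of_ne (by exact_mod_cast h1) hne
    rcases Nat.eq_zero_or_pos (l'.2 : ℕ) with h0 | h0
    · apply not_precedes_of_first v l' l h0
      have hlt : I.listSlots s l < s l'.1 := by
        simpa [listSlots, h0] using h1
      obtain ⟨j', -, k', hk', h', hr⟩ := hs.filled l'.1 (Finset.mem_univ _) _ hlt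
      have := (hs.inj j' (Finset.mem_univ _) l.1 (Finset.mem_univ _) k' hk' l.2 l.2.2 h').1
      rwa [this] at hr
    · have := IsListSchedule.start_eq_of_isAvailable l' _ h0 h
      rw [start_ofSlots] at this
      exact absurd (by exact_mod_cast this.symm) hne

end ReentrantShop

/-! ### WLRL schedules are list schedules; the upper bound. -/

namespace ReentrantShop

variable {I : ReentrantShop}

theorem IsWLRL.completion_eq {v : WLRLVariant} {σ : I.Schedule} (hσ : I.IsWLRL v σ) (l : I.Loop) :
    I.completion σ l = I.start σ l + I.m := by
  simp only [completion]
  rw [hσ.no_wait]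
  simp only [lastMachine]
  rw [Nat.cast_sub I.m_pos]
  push_cast; ring

theorem IsWLRL.start_add_le {v : WLRLVariant} {σ : I.Schedule} (hσ : I.IsWLRL v σ) (j : Fin I.n)
    (k : ℕ) : ∀ d (hk : k + (d + 1) < I.loops j),
      I.start σ ⟨j, ⟨k, by omega⟩⟩ + I.m ≤ I.start σ ⟨j, ⟨k + (d + 1), hk⟩⟩ := by
  intro d
  induction d with
  | zero =>
    intro hk
    have := hσ.feasible.reentry j ⟨k, by omega⟩ ⟨k + 1, hk⟩ rfl
    rwa [hσ.completion_eq] at this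
  | succ d ih =>
    intro hk
    have h1 := ih (by omega)
    have h2 := hσ.feasible.reentry j ⟨k + (d + 1), by omega⟩ ⟨k + (d + 1 + 1), hk⟩ rfl
    rw [hσ.completion_eq] at h2
    linarith [(Nat.cast_nonneg I.m : (0 : ℝ) ≤ _)]

theorem IsWLRL.start_add_le_of_lt {v : WLRLVariant} {σ : I.Schedule} (hσ : I.IsWLRL v σ)
    (j : Fin I.n) {k k' : Fin (I.loops j)} (h : k < k') :
    I.start σ ⟨j, k⟩ + I.m ≤ I.start σ ⟨j, k'⟩ := by
  obtain ⟨k, hk⟩ := k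
  obtain ⟨k', hk'⟩ := k'
  obtain ⟨d, rfl⟩ : ∃ d, k' = k + (d + 1) := ⟨k' - k - 1, by rw [Fin.lt_def] at h; simp at h; omega⟩
  exact hσ.start_add_le j k d hk'

theorem IsWLRL.start_le_of_le {v : WLRLVariant} {σ : I.Schedule} (hσ : I.IsWLRL v σ)
    (j : Fin I.n) {k k' : Fin (I.loops j)} (h : k ≤ k') :
    I.start σ ⟨j, k⟩ ≤ I.start σ ⟨j, k'⟩ := by
  rcases h.lt_or_eq with h | rfl
  · linarith [hσ.start_add_le_of_lt j h, (Nat.cast_nonneg I.m : (0 : ℝ) ≤ _)]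
  · exact le_rfl

theorem IsWLRL.start_injective {v : WLRLVariant} {σ : I.Schedule} (hσ : I.IsWLRL v σ) :
    Function.Injective (I.start σ) := by
  intro l l' h
  by_contra hne
  simp only [start] at h
  rcases hσ.feasible.capacity I.firstMachine l l' hne with h' | h' <;> linarith

/-- The first loop of a job. -/
def firstLoop (I : ReentrantShop) (j : Fin I.n) : I.Loop := ⟨j, ⟨0, I.loops_pos j⟩⟩

theorem isAvailable_firstLoop (σ : I.Schedule) (j : Fin I.n) (t : ℝ)
    (h : t ≤ I.start σ (I.firstLoop j)) : I.IsAvailable σ (I.firstLoop j) t :=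
  ⟨h, fun _ hk => absurd hk (Nat.not_lt_zero _)⟩

/-- A job that is started earlier has at least the same ratio. -/
theorem IsWLRL.ratio_le {v : WLRLVariant} {σ : I.Schedule} (hσ : I.IsWLRL v σ) {j j' : Fin I.n}
    (h : I.start σ (I.firstLoop j) ≤ I.start σ (I.firstLoop j')) : I.ratio j' ≤ I.ratio j :=
  ratio_le_of_not_precedes v (I.firstLoop j') (I.firstLoop j) rfl rfl
    (hσ.select _ _ (isAvailable_firstLoop σ j' _ h))

/-- In a WLRL schedule all loops start at integral times, and a started job never pauses. -/
theorem IsWLRL.integral_and_contiguous {v : WLRLVariant} {σ : I.Schedule} (hσ : I.IsWLRL v σ)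
    (l : I.Loop) : (∃ a : ℕ, I.start σ l = a) ∧ ∀ k : Fin (I.loops l.1), (k : ℕ) + 1 = l.2 →
      I.start σ l = I.start σ ⟨l.1, k⟩ + I.m := by
  by_contra hbad
  -- A counterexample with the earliest start: all loops started before it are integral and
  -- contiguous.
  obtain ⟨l, hl, hmin⟩ := Set.exists_min_image {l : I.Loop | ¬ ((∃ a : ℕ, I.start σ l = a) ∧
    ∀ k : Fin (I.loops l.1), (k : ℕ) + 1 = l.2 → I.start σ l = I.start σ ⟨l.1, k⟩ + I.m)}
    (I.start σ) (Set.toFinite _) ⟨l, hbad⟩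
  have hgood : ∀ l', I.start σ l' < I.start σ l → (∃ a : ℕ, I.start σ l' = a) ∧
      ∀ k : Fin (I.loops l'.1), (k : ℕ) + 1 = l'.2 →
        I.start σ l' = I.start σ ⟨l'.1, k⟩ + I.m := by
    intro l' h
    by_contra hb
    exact absurd (hmin l' hb) (not_le.2 h)
  have hm : (1 : ℝ) ≤ I.m := by exact_mod_cast I.m_pos
  have hnn : ∀ l, 0 ≤ I.start σ l := fun l => hσ.feasible.nonneg _ l
  have hbusy : ∀ a : ℕ, (a : ℝ) < I.start σ l → I.IsAvailable σ l a → ∃ l', I.start σ l' = a := by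
    intro a ha hav
    obtain ⟨l', h1, h2⟩ := hσ.busy a l (Nat.cast_nonneg _) hav
    obtain ⟨b, hb⟩ := (hgood l' (by linarith)).1
    refine ⟨l', ?_⟩
    rw [hb] at h1 h2 ⊢
    have h1 : b ≤ a := by exact_mod_cast h1
    have h2 : a < b + 1 := by exact_mod_cast h2
    have : a = b := by omega
    rw [this]
  have hcont : ∀ k : Fin (I.loops l.1), (k : ℕ) + 1 = l.2 →
      I.start σ l = I.start σ ⟨l.1, k⟩ + I.m := by
    intro k hk
    have hkl : k < l.2 := by rw [Fin.lt_def]; omega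
    have hle : I.start σ ⟨l.1, k⟩ + I.m ≤ I.start σ l := hσ.start_add_le_of_lt l.1 hkl
    by_contra hne
    have hlt : I.start σ ⟨l.1, k⟩ + I.m < I.start σ l := lt_of_le_of_ne hle (Ne.symm hne)
    obtain ⟨a, ha⟩ := (hgood ⟨l.1, k⟩ (by linarith)).1
    have hcast : ((a + I.m : ℕ) : ℝ) = I.start σ ⟨l.1, k⟩ + I.m := by rw [ha]; push_cast; ring
    have hav : I.IsAvailable σ l ((a + I.m : ℕ) : ℝ) := by
      refine ⟨by rw [hcast]; exact hle, fun k' hk' => ?_⟩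
      rw [hσ.completion_eq, hcast]
      have : k' ≤ k := by rw [Fin.le_def]; rw [Fin.lt_def] at hk'; omega
      linarith [hσ.start_le_of_le l.1 this]
    obtain ⟨l', hl'⟩ := hbusy _ (by rw [hcast]; exact hlt) hav
    have hnot := hσ.select l' l (by rw [hl']; exact hav)
    rw [hcast] at hl'
    -- If `l` pauses, some `l'` starts at the moment `l` becomes available. If `l'` is the first
    -- loop of its job, that job started later, has no larger ratio and must yield to `l`. Otherwise
    -- `l'` is contiguous, its predecessor starts together with that of `l`, and `l' = l`.
    rcases Nat.eq_zero_or_pos (l'.2 : ℕ) with h0 | h0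
    · apply hnot
      apply precedes_of_started v l l' (by omega) h0
      have e : l' = I.firstLoop l'.1 := by
        obtain ⟨j', ⟨k', hk'⟩⟩ := l'
        simp only at h0
        subst h0
        rfl
      apply hσ.ratio_le
      rw [← e, hl']
      have : I.start σ (I.firstLoop l.1) ≤ I.start σ ⟨l.1, k⟩ :=
        hσ.start_le_of_le l.1 (by rw [Fin.le_def]; simp)
      linarith
    · have hg := (hgood l' (by rw [hl']; exact hlt)).2 ⟨l'.2 - 1, by have := l'.2.2; omega⟩
        (by simp only; omega)
      have heq := hσ.start_injective (show I.start σ ⟨l'.1, ⟨l'.2 - 1, by have := l'.2.2; omega⟩⟩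
        = I.start σ ⟨l.1, k⟩ by linarith)
      have : l' = l := by
        obtain ⟨j, kl⟩ := l
        obtain ⟨j', kl'⟩ := l'
        simp only [Sigma.mk.injEq] at heq
        obtain ⟨h1, h2⟩ := heq
        subst h1
        have h2 := congrArg Fin.val (eq_of_heq h2)
        simp only at h2 hk h0
        congr 1
        ext
        omega
      rw [this] at hl'
      linarith
  apply hl
  refine ⟨?_, hcont⟩
  rcases Nat.eq_zero_or_pos (l.2 : ℕ) with h0 | h0
  -- At the integer part of a fractional start, the waiting first loop forces another loop to start
  -- there, which still occupies machine 1 when `l` starts.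
  · by_contra hint
    push Not at hint
    have hlt : (⌊I.start σ l⌋₊ : ℝ) < I.start σ l :=
      lt_of_le_of_ne (Nat.floor_le (hnn l)) (Ne.symm (hint _))
    have hav : I.IsAvailable σ l (⌊I.start σ l⌋₊ : ℝ) :=
      ⟨hlt.le, fun k hk => by rw [Fin.lt_def] at hk; omega⟩
    obtain ⟨l', hl'⟩ := hbusy _ hlt hav
    have hne : l' ≠ l := by
      rintro rfl
      linarith
    have h1 := Nat.lt_floor_add_one (I.start σ l)
    have h2 := hσ.feasible.capacity I.firstMachine l' l hne
    change I.start σ l' + 1 ≤ I.start σ l ∨ I.start σ l + 1 ≤ I.start σ l' at h2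
    rcases h2 with h2 | h2 <;> linarith
  · have h := hcont ⟨l.2 - 1, by have := l.2.2; omega⟩ (by simp only; omega)
    obtain ⟨a, ha⟩ := (hgood ⟨l.1, ⟨l.2 - 1, by have := l.2.2; omega⟩⟩ (by linarith)).1
    exact ⟨a + I.m, by rw [h, ha]; push_cast; ring⟩

/-- Every WLRL schedule is a list schedule. -/
theorem IsWLRL.exists_listSchedule {v : WLRLVariant} {σ : I.Schedule} (hσ : I.IsWLRL v σ) :
    ∃ s, I.IsListSchedule Finset.univ s ∧ ∀ l : I.Loop, I.start σ l = I.listSlots s l := by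
  choose s hs using fun j => (hσ.integral_and_contiguous (I.firstLoop j)).1
  have hslot : ∀ j, ∀ k, ∀ hk : k < I.loops j,
      I.start σ ⟨j, ⟨k, hk⟩⟩ = ((s j + k * I.m : ℕ) : ℝ) := by
    intro j k
    induction k with
    | zero => intro hk; simpa [firstLoop] using hs j
    | succ k ih =>
      intro hk
      rw [(hσ.integral_and_contiguous ⟨j, ⟨k + 1, hk⟩⟩).2 ⟨k, by simp only; omega⟩ rfl, ih (by omega)]
      push_cast; ring
  refine ⟨s, ⟨?_, ?_⟩, fun l => hslot l.1 l.2 l.2.2⟩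
  · intro j _ j' _ k hk k' hk' h
    have heq : (⟨j, ⟨k, hk⟩⟩ : I.Loop) = ⟨j', ⟨k', hk'⟩⟩ := hσ.start_injective (by
      rw [hslot, hslot, h])
    simp only [Sigma.mk.injEq] at heq
    obtain ⟨h1, h2⟩ := heq
    subst h1
    exact ⟨rfl, congrArg Fin.val (eq_of_heq h2)⟩
  · intro j _ t ht
    have ht' : (t : ℝ) < s j := by exact_mod_cast ht
    obtain ⟨l', h1, h2⟩ := hσ.busy t (I.firstLoop j) (Nat.cast_nonneg _)
      (isAvailable_firstLoop σ j t (by rw [hs]; exact ht'.le))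
    have h0 : I.start σ (I.firstLoop l'.1) ≤ I.start σ l' :=
      hσ.start_le_of_le l'.1 (by rw [Fin.le_def]; simp)
    rw [show I.start σ l' = _ from hslot l'.1 l'.2 l'.2.2] at h1 h2
    have h1' : s l'.1 + l'.2 * I.m ≤ t := by exact_mod_cast h1
    have h2' : t < s l'.1 + l'.2 * I.m + 1 := by exact_mod_cast h2
    refine ⟨l'.1, Finset.mem_univ _, l'.2, l'.2.2, by omega, hσ.ratio_le ?_⟩
    rw [hs j]
    refine h0.trans ?_
    rw [show I.start σ l' = _ from hslot l'.1 l'.2 l'.2.2]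
    linarith

theorem IsWLRL.jobCompletion_eq {v : WLRLVariant} {σ : I.Schedule} (hσ : I.IsWLRL v σ)
    {s : Fin I.n → ℕ} (hs : ∀ l : I.Loop, I.start σ l = I.listSlots s l) (j : Fin I.n) :
    I.jobCompletion σ j = s j + I.m * I.loops j := by
  rw [jobCompletion, hσ.completion_eq, hs]
  simp only [listSlots, lastLoop]
  push_cast [Nat.cast_sub (I.loops_pos j)]
  ring

/-- Performance guarantee of the WLRL rule. -/
theorem IsWLRL.cost_le {v : WLRLVariant} {σ τ : I.Schedule} (hσ : I.IsWLRL v σ)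
    (hτ : I.IsFeasible τ) : I.cost σ ≤ (1 + √2) / 2 * I.cost τ := by
  classical
  obtain ⟨s, hs, hstart⟩ := hσ.exists_listSchedule
  obtain ⟨x, hx, hxτ⟩ := hτ.exists_slotting
  have hLpos : ∀ j, (0 : ℝ) < I.loops j := fun j => by exact_mod_cast I.loops_pos j
  -- The default value 0 beyond the last loop is never used.
  obtain ⟨y, hy⟩ : ∃ y : Fin I.n → ℕ → ℕ, ∀ j k, ∀ hk : k < I.loops j, y j k = x ⟨j, ⟨k, hk⟩⟩ :=
    ⟨fun j k => if hk : k < I.loops j then x ⟨j, ⟨k, hk⟩⟩ else 0, fun j k hk => by simp [hk]⟩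
  -- The slots before a job of the level set are filled by jobs of at least its ratio, which belong
  -- to the level set too; hence `list_schedule_bound` applies to it.
  have hlevel : ∀ θ : ℝ, 0 ≤ ∑ j ∈ Finset.univ with θ ≤ I.ratio j,
      (I.loops j * ((1 + √2) / 2 * I.jobCompletion τ j - I.jobCompletion σ j) : ℝ) := by
    intro θ
    have h := list_schedule_bound (Finset.univ.filter fun j => θ ≤ I.ratio j) I.m I.loops s y
      I.m_pos (fun j _ => I.loops_pos j)
      (fun j _ j' _ => hs.inj j (Finset.mem_univ _) j' (Finset.mem_univ _))
      (by
        intro j hj t ht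
        obtain ⟨j', -, k, hk, h, hr⟩ := hs.filled j (Finset.mem_univ _) t ht
        exact ⟨j', Finset.mem_filter.2 ⟨Finset.mem_univ _,
          (Finset.mem_filter.1 hj).2.trans hr⟩, k, hk, h⟩)
      (by
        intro j _ j' _ k hk k' hk' h
        rw [hy j k hk, hy j' k' hk'] at h
        have heq := hx.inj h
        simp only [Sigma.mk.injEq] at heq
        obtain ⟨h1, h2⟩ := heq
        subst h1
        exact ⟨rfl, congrArg Fin.val (eq_of_heq h2)⟩)
      (by
        intro j _ k hk
        rw [hy j k (by omega), hy j (k + 1) hk]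
        exact hx.step j _ _ rfl)
    have h1 : ∑ j ∈ Finset.univ with θ ≤ I.ratio j, (I.loops j * I.jobCompletion σ j : ℝ) =
        ∑ j ∈ Finset.univ with θ ≤ I.ratio j, (I.loops j : ℝ) * (s j + I.m * I.loops j) :=
      Finset.sum_congr rfl fun j _ => by rw [hσ.jobCompletion_eq hstart]
    have h2 : ∑ j ∈ Finset.univ with θ ≤ I.ratio j,
        (I.loops j : ℝ) * (y j (I.loops j - 1) + I.m) ≤
        ∑ j ∈ Finset.univ with θ ≤ I.ratio j, (I.loops j : ℝ) * I.jobCompletion τ j := by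
      apply Finset.sum_le_sum
      intro j _
      apply mul_le_mul_of_nonneg_left _ (hLpos j).le
      rw [hy j _ (Nat.sub_lt (I.loops_pos j) Nat.one_pos)]
      exact hxτ j
    have h3 : ∑ j ∈ Finset.univ with θ ≤ I.ratio j,
        (I.loops j * ((1 + √2) / 2 * I.jobCompletion τ j - I.jobCompletion σ j) : ℝ) =
        (1 + √2) / 2 * ∑ j ∈ Finset.univ with θ ≤ I.ratio j,
          (I.loops j : ℝ) * I.jobCompletion τ j -
        ∑ j ∈ Finset.univ with θ ≤ I.ratio j, (I.loops j * I.jobCompletion σ j : ℝ) := by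
      rw [Finset.mul_sum, ← Finset.sum_sub_distrib]
      exact Finset.sum_congr rfl fun j _ => by ring
    rw [h3, h1]
    have hρ : (0 : ℝ) ≤ (1 + √2) / 2 := by positivity
    linarith [mul_le_mul_of_nonneg_left h2 hρ]
  have h := sum_mul_nonneg_of_level_sets _ Finset.univ I.ratio
    (fun j _ => (div_pos (I.w_pos j) (hLpos j)).le) hlevel
  have e : ∑ j, I.ratio j * (I.loops j * ((1 + √2) / 2 * I.jobCompletion τ j -
      I.jobCompletion σ j)) = (1 + √2) / 2 * I.cost τ - I.cost σ := by
    rw [cost, cost, Finset.mul_sum, ← Finset.sum_sub_distrib]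
    refine Finset.sum_congr rfl fun j _ => ?_
    rw [ratio]
    field_simp [(hLpos j).ne']
  rw [e] at h
  linarith

end ReentrantShop

/-! ### Tightness: long jobs against unit jobs. -/

namespace ReentrantShop

/-- `k` long jobs with `Q` loops and weight `Q - 1`, and `S` jobs with a single loop and
weight `1`. -/
noncomputable def longAndUnitJobs (m k Q S : ℕ) (hm : 0 < m) (hS : 0 < S) (hQ : 1 < Q) :
    ReentrantShop where
  m := m
  n := k + S
  loops j := if (j : ℕ) < k then Q else 1
  w j := if (j : ℕ) < k then (Q : ℝ) - 1 else 1
  m_pos := hm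
  n_pos := by omega
  loops_pos j := by split_ifs <;> omega
  w_pos j := by
    have : (1 : ℝ) < Q := by exact_mod_cast hQ
    split_ifs <;> linarith

section

variable {m k Q S : ℕ} (hm : 0 < m) (hS : 0 < S) (hQ : 1 < Q)

local notation "J" => longAndUnitJobs m k Q S hm hS hQ

/-- The long jobs. -/
def longJob (j : Fin k) : Fin (ReentrantShop.n J) := Fin.castAdd S j

/-- The unit jobs. -/
def unitJob (a : Fin S) : Fin (ReentrantShop.n J) := Fin.natAdd k a

theorem cost_longAndUnitJobs (σ : Schedule J) : cost J σ =
    ∑ j : Fin k, ((Q : ℝ) - 1) * jobCompletion J σ (longJob hm hS hQ j) +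
      ∑ a : Fin S, jobCompletion J σ (unitJob hm hS hQ a) := by
  rw [cost]
  change ∑ j : Fin (k + S), _ = _
  rw [Fin.sum_univ_add]
  congr 1
  · refine Finset.sum_congr rfl fun j _ => ?_
    simp [longAndUnitJobs, longJob]
  · refine Finset.sum_congr rfl fun j _ => ?_
    simp [longAndUnitJobs, unitJob]

/-- Unit jobs have ratio 1 and long jobs `(Q - 1) / Q < 1`, so no long job starts in the first `S`
slots. The `m` slots that a unit job needs after its start are dropped, being of lower order. -/
theorem le_cost_of_isWLRL {v : WLRLVariant} {σ : Schedule J} (hσ : IsWLRL J v σ) :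
    (k : ℝ) * (Q - 1) * (S + m * Q) + S * (S - 1) / 2 ≤ cost J σ := by
  obtain ⟨s, hs, hstart⟩ := hσ.exists_listSchedule
  have hQ1 : (1 : ℝ) < Q := by exact_mod_cast hQ
  have hloopL : ∀ j : Fin k, loops J (longJob hm hS hQ j) = Q := fun j => by
    simp [longAndUnitJobs, longJob]
  have hJm : ReentrantShop.m J = m := rfl
  have hinj : Function.Injective fun a : Fin S => s (unitJob hm hS hQ a) := by
    intro a a' h
    have := (hs.inj (unitJob hm hS hQ a) (Finset.mem_univ _) (unitJob hm hS hQ a')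
      (Finset.mem_univ _) 0 (loops_pos _ _) 0 (loops_pos _ _) (by simpa using h)).1
    have := congrArg Fin.val this
    simp only [unitJob, Fin.val_natAdd] at this
    exact Fin.ext (by omega)
  have hlong : ∀ j : Fin k, S ≤ s (longJob hm hS hQ j) := by
    intro j
    by_contra hlt
    push Not at hlt
    have hne : ∀ a : Fin S, s (unitJob hm hS hQ a) ≠ s (longJob hm hS hQ j) := by
      intro a h
      have := (hs.inj (unitJob hm hS hQ a) (Finset.mem_univ _) (longJob hm hS hQ j)
        (Finset.mem_univ _) 0 (loops_pos _ _) 0 (loops_pos _ _) (by simpa using h)).1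
      have := congrArg Fin.val this
      simp [longJob, unitJob] at this
      omega
    -- Pigeonhole: a long job in one of the first `S` slots pushes a unit job out of them, and the
    -- filling condition for that unit job then fails.
    have hlate : ∃ a : Fin S, S ≤ s (unitJob hm hS hQ a) := by
      by_contra hall
      push Not at hall
      have hsub : Finset.univ.image (fun a : Fin S => s (unitJob hm hS hQ a)) ⊆
          (Finset.range S).erase (s (longJob hm hS hQ j)) := by
        intro t ht
        obtain ⟨a, -, rfl⟩ := Finset.mem_image.1 ht
        exact Finset.mem_erase.2 ⟨hne a, Finset.mem_range.2 (hall a)⟩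
      have := Finset.card_le_card hsub
      rw [Finset.card_image_of_injective _ hinj, Finset.card_erase_of_mem (Finset.mem_range.2 hlt)]
        at this
      simp at this
      omega
    obtain ⟨a, ha⟩ := hlate
    obtain ⟨j', -, k', hk', h', hr⟩ := hs.filled (unitJob hm hS hQ a) (Finset.mem_univ _)
      (s (longJob hm hS hQ j)) (by omega)
    have := (hs.inj j' (Finset.mem_univ _) (longJob hm hS hQ j) (Finset.mem_univ _) k' hk' 0
      (loops_pos _ _) (by simpa using h')).1
    subst this
    have h1 : ratio J (unitJob hm hS hQ a) = 1 := by
      simp [ratio, longAndUnitJobs, unitJob]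
    have h2 : ratio J (longJob hm hS hQ j) < 1 := by
      have : ratio J (longJob hm hS hQ j) = ((Q : ℝ) - 1) / Q := by
        simp [ratio, longAndUnitJobs, longJob]
      rw [this, div_lt_one (by linarith)]
      linarith
    linarith
  rw [cost_longAndUnitJobs]
  apply add_le_add
  · have : (k : ℝ) * (Q - 1) * (S + m * Q) = ∑ j : Fin k, ((Q : ℝ) - 1) * (S + m * Q) := by
      simp; ring
    rw [this]
    refine Finset.sum_le_sum fun j _ => mul_le_mul_of_nonneg_left ?_ (by linarith)
    rw [hσ.jobCompletion_eq hstart, hloopL, hJm]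
    have : (S : ℝ) ≤ s (longJob hm hS hQ j) := by exact_mod_cast hlong j
    linarith
  · have hS1 : (1 : ℝ) ≤ S := by exact_mod_cast hS
    have h1 := le_sum_of_injOn Finset.univ _ hinj.injOn ((S : ℝ) - 1 / 2) (by linarith)
    have h2 : 0 ≤ ∑ a : Fin S, max ((s (unitJob hm hS hQ a) : ℝ) - (S - 1 / 2)) 0 :=
      Finset.sum_nonneg fun _ _ => le_max_right _ _
    simp only [Finset.card_univ, Fintype.card_fin] at h1
    have h3 : ∑ a : Fin S, (s (unitJob hm hS hQ a) : ℝ) ≤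
        ∑ a : Fin S, jobCompletion J σ (unitJob hm hS hQ a) := by
      refine Finset.sum_le_sum fun a _ => ?_
      rw [hσ.jobCompletion_eq hstart]
      exact le_add_of_nonneg_right (by positivity)
    nlinarith

/-- The slots in which the long jobs are started first, and the unit jobs are distributed over the
remaining residues modulo `m`. -/
def longFirstSlots (l : Loop J) : ℕ :=
  if (l.1 : ℕ) < k then l.1 + l.2 * m
  else k + ((l.1 : ℕ) - k) % (m - k) + ((l.1 : ℕ) - k) / (m - k) * m

/-- Residue and quotient modulo `m` recover the loop: residues below `k` belong to long jobs, the
others to unit jobs. -/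
theorem isSlotting_longFirstSlots (hk : k < m) : IsSlotting J (longFirstSlots hm hS hQ) where
  inj := by
    have key : ∀ l : Loop J, longFirstSlots hm hS hQ l % m =
        (if (l.1 : ℕ) < k then (l.1 : ℕ) else k + ((l.1 : ℕ) - k) % (m - k)) ∧
        longFirstSlots hm hS hQ l / m =
        (if (l.1 : ℕ) < k then (l.2 : ℕ) else ((l.1 : ℕ) - k) / (m - k)) := by
      intro l
      have hmod := Nat.mod_lt ((l.1 : ℕ) - k) (show 0 < m - k by omega)
      simp only [longFirstSlots]
      split_ifs with h
      · rw [Nat.add_mul_mod_self_right, Nat.add_mul_div_right _ _ hm,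
          Nat.mod_eq_of_lt (by omega), Nat.div_eq_of_lt (by omega)]
        simp
      · rw [Nat.add_mul_mod_self_right, Nat.add_mul_div_right _ _ hm,
          Nat.mod_eq_of_lt (by omega), Nat.div_eq_of_lt (by omega)]
        simp
    intro l l' h
    obtain ⟨h1, h2⟩ := key l
    obtain ⟨h3, h4⟩ := key l'
    rw [h] at h1 h2
    rw [h1] at h3
    rw [h2] at h4
    have hfst : (l.1 : ℕ) = l'.1 ∧ (l.2 : ℕ) = l'.2 := by
      have hu : ∀ l : Loop J, ¬ (l.1 : ℕ) < k → (l.2 : ℕ) = 0 := by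
        intro l hl
        have := l.2.2
        simp only [longAndUnitJobs, hl, if_false] at this
        omega
      by_cases hl : (l.1 : ℕ) < k <;> by_cases hl' : (l'.1 : ℕ) < k
      · simp only [hl, hl', if_true] at h3 h4
        exact ⟨h3, h4⟩
      · simp only [hl, hl', if_true, if_false] at h3
        omega
      · simp only [hl, hl', if_true, if_false] at h3
        omega
      · simp only [hl, hl', if_false] at h3 h4
        refine ⟨?_, by rw [hu l hl, hu l' hl']⟩
        have e := Nat.div_add_mod ((l.1 : ℕ) - k) (m - k)
        have e' := Nat.div_add_mod ((l'.1 : ℕ) - k) (m - k)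
        rw [h4, Nat.add_left_cancel h3, e'] at e
        omega
    obtain ⟨j, i⟩ := l
    obtain ⟨j', i'⟩ := l'
    have h5 : j = j' := Fin.ext hfst.1
    subst h5
    have h6 : i = i' := Fin.ext hfst.2
    rw [h6]
  step j i i' h := by
    have hj : (j : ℕ) < k := by
      by_contra hj
      have := i'.2
      simp only [longAndUnitJobs, hj, if_false] at this
      omega
    simp only [longFirstSlots, hj, if_true]
    rw [← h, Nat.succ_mul]
    simp only [longAndUnitJobs]
    omega

/-- Unit jobs start at rate `(m - k) / m`, so the one numbered `a` is completed by `2 * m + a * m /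
(m - k)`. -/
theorem cost_longFirstSlots_le (hk : k < m) :
    cost J (ofSlots J (longFirstSlots hm hS hQ)) ≤
      (k : ℝ) * (Q - 1) * (k + Q * m) + (m * S ^ 2 / (2 * (m - k)) + 2 * m * S) := by
  have hQ1 : (1 : ℝ) < Q := by exact_mod_cast hQ
  have hp : (0 : ℝ) < m - k := by
    have : (k : ℝ) < m := by exact_mod_cast hk
    linarith
  rw [cost_longAndUnitJobs]
  apply add_le_add
  · have : (k : ℝ) * (Q - 1) * (k + Q * m) = ∑ j : Fin k, ((Q : ℝ) - 1) * (k + Q * m) := by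
      simp; ring
    rw [this]
    refine Finset.sum_le_sum fun j _ => mul_le_mul_of_nonneg_left ?_ (by linarith)
    rw [jobCompletion, completion_ofSlots]
    have e : longFirstSlots hm hS hQ (lastLoop J (longJob hm hS hQ j)) = j + (Q - 1) * m := by
      simp [longFirstSlots, lastLoop, longAndUnitJobs, longJob]
    rw [e]
    push_cast [Nat.cast_sub hQ.le]
    have : ((j : ℕ) : ℝ) ≤ k := by exact_mod_cast j.2.le
    simp only [longAndUnitJobs]
    linarith
  · have h1 : ∀ a : Fin S,
        jobCompletion J (ofSlots J (longFirstSlots hm hS hQ)) (unitJob hm hS hQ a) ≤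
        2 * m + (a : ℕ) * (m / (m - k) : ℝ) := by
      intro a
      rw [jobCompletion, completion_ofSlots]
      have e : longFirstSlots hm hS hQ (lastLoop J (unitJob hm hS hQ a)) =
          k + (a : ℕ) % (m - k) + (a : ℕ) / (m - k) * m := by
        simp [longFirstSlots, lastLoop, unitJob]
      rw [e]
      have hmod := Nat.mod_lt (a : ℕ) (show 0 < m - k by omega)
      have h2 : ((k + (a : ℕ) % (m - k) : ℕ) : ℝ) ≤ m := by exact_mod_cast (by omega)
      have h3 : (((a : ℕ) / (m - k) : ℕ) : ℝ) ≤ (a : ℕ) / (m - k) := by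
        have := Nat.cast_div_le (α := ℝ) (m := (a : ℕ)) (n := m - k)
        rwa [Nat.cast_sub hk.le] at this
      have h4 := mul_le_mul_of_nonneg_right h3 (Nat.cast_nonneg m : (0 : ℝ) ≤ m)
      have h5 : ((a : ℕ) / (m - k) * m : ℝ) = (a : ℕ) * (m / (m - k)) := by ring
      push_cast at h2 ⊢
      change _ + (m : ℝ) ≤ _
      linarith
    refine (Finset.sum_le_sum fun a _ => h1 a).trans ?_
    rw [Fin.sum_univ_eq_sum_range (fun a : ℕ => (2 * m + a * (m / (m - k)) : ℝ)) S,
      sum_range_arith]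
    have h6 : (m : ℝ) * S ^ 2 / (2 * (m - k)) = m / (m - k) * S * S / 2 := by
      field_simp
    rw [h6]
    have h7 : (0 : ℝ) ≤ m / (m - k) * S := by positivity
    linarith

end

/-- The two quartic forms are the leading coefficients of the cost bounds in `exists_bad_instance`,
with `M = m` and `P = m - k`. At `M / P = √2` their quotient is `(3 + 2√2) / (2 + 2√2) = ρ`; the
strict inequality is an open condition, so a rational `M / P` also satisfies it. -/
theorem exists_ratio_near_sqrt_two {α : ℝ} (hα : α < (1 + √2) / 2) :
    ∃ M P : ℕ, 0 < P ∧ P < M ∧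
      α * (((M : ℝ) - P) * (M + P) ^ 2 * M + M ^ 3 * P / 2) <
        ((M : ℝ) - P) * M * (2 * P + M) * (M + P) + M ^ 2 * P ^ 2 / 2 := by
  have hr2 : √2 * √2 = 2 := Real.mul_self_sqrt (by norm_num)
  have hr0 : 1 < √2 := by rw [Real.lt_sqrt (by norm_num)]; norm_num
  have hopen : IsOpen {u : ℝ | 1 < u ∧ α * ((u - 1) * (u + 1) ^ 2 * u + u ^ 3 / 2) <
      (u - 1) * u * (2 + u) * (u + 1) + u ^ 2 / 2} :=
    IsOpen.and (isOpen_lt continuous_const continuous_id)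
      (isOpen_lt (by fun_prop) (by fun_prop))
  obtain ⟨q, hq1, hq⟩ := Rat.denseRange_cast.exists_mem_open hopen ⟨√2, hr0, by
    have e1 : (√2 - 1) * (√2 + 1) ^ 2 * √2 + √2 ^ 3 / 2 = 2 + 2 * √2 := by
      linear_combination (√2 ^ 2 + √2 * 3 / 2 + 1) * hr2
    have e2 : (√2 - 1) * √2 * (2 + √2) * (√2 + 1) + √2 ^ 2 / 2 = 3 + 2 * √2 := by
      linear_combination (√2 ^ 2 + 2 * √2 + 3 / 2) * hr2
    rw [e1, e2]
    nlinarith⟩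
  have hq1' : (1 : ℚ) < q := by exact_mod_cast hq1
  have hden : (0 : ℝ) < q.den := by exact_mod_cast q.den_pos
  have hnum : ((q.num.toNat : ℕ) : ℝ) = q * q.den := by
    have h1 : ((q.num.toNat : ℕ) : ℤ) = q.num :=
      Int.toNat_of_nonneg (Rat.num_nonneg.2 (by linarith))
    have h2 : (q.num : ℚ) = q * q.den := (Rat.mul_den_eq_num q).symm
    have h3 : ((q.num.toNat : ℕ) : ℝ) = ((q.num : ℤ) : ℝ) := by
      exact_mod_cast congrArg (fun a : ℤ => (a : ℝ)) h1
    rw [h3]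
    exact_mod_cast congrArg (fun a : ℚ => (a : ℝ)) h2
  refine ⟨q.num.toNat, q.den, q.den_pos, ?_, ?_⟩
  · have : (q.den : ℝ) < q.num.toNat := by rw [hnum]; nlinarith
    exact_mod_cast this
  · rw [hnum]
    have h4 : (0 : ℝ) < (q.den : ℝ) ^ 4 := by positivity
    have := mul_lt_mul_of_pos_right hq h4
    calc _ = _ := ?_
      _ < _ := this
      _ = _ := ?_
    · ring
    · ring

theorem exists_bad_instance (v : WLRLVariant) {α : ℝ} (hα : α < (1 + √2) / 2) :
    ∃ I : ReentrantShop, ∀ σ τ : I.Schedule, I.IsWLRL v σ → I.IsOptimal τ →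
      α < I.cost σ / I.cost τ := by
  wlog hα0 : 0 ≤ α generalizing α
  · obtain ⟨I, hI⟩ := this (α := 0) (by positivity) le_rfl
    exact ⟨I, fun σ τ hσ hτ => (not_le.1 hα0).trans (hI σ τ hσ hτ)⟩
  obtain ⟨M, P, hP, hPM, hMP⟩ := exists_ratio_near_sqrt_two hα
  obtain ⟨k, rfl⟩ : ∃ k, M = k + P := ⟨M - P, by omega⟩
  -- With `Q = (m + P) * N` and `S = m * P * N`, both cost bounds are quadratic in `N`. This `N`
  -- makes the gap between the `N²` terms exceed the terms linear in `N`, collected on the left.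
  obtain ⟨N, hN⟩ : ∃ N : ℕ, α * ((k : ℝ) ^ 2 * (k + P + P) + 2 * (k + P) ^ 2 * P) +
      (k * (k + P) * (2 * P + (k + P)) + (k + P) * P / 2) <
      N * ((k * (k + P) * (2 * P + (k + P)) * (k + P + P) + (k + P) ^ 2 * P ^ 2 / 2) -
        α * (k * (k + P + P) ^ 2 * (k + P) + (k + P) ^ 3 * P / 2)) := by
    push_cast at hMP
    rw [add_sub_cancel_right] at hMP
    obtain ⟨N, hN⟩ := exists_nat_gt ((α * ((k : ℝ) ^ 2 * (k + P + P) + 2 * (k + P) ^ 2 * P) +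
      (k * (k + P) * (2 * P + (k + P)) + (k + P) * P / 2)) /
      ((k * (k + P) * (2 * P + (k + P)) * (k + P + P) + (k + P) ^ 2 * P ^ 2 / 2) -
        α * (k * (k + P + P) ^ 2 * (k + P) + (k + P) ^ 3 * P / 2)))
    refine ⟨N, ?_⟩
    rwa [div_lt_iff₀ (by linarith)] at hN
  have hN0 : 0 < N := by
    rcases Nat.eq_zero_or_pos N with rfl | h
    · rw [Nat.cast_zero, zero_mul] at hN
      exact absurd hN (not_lt.2 (by positivity))
    · exact h
  have hm : 0 < k + P := by omega
  have hS : 0 < (k + P) * P * N := by positivity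
  have hQ : 1 < (k + P + P) * N := by
    have : 1 * 1 < (k + P + P) * N := Nat.mul_lt_mul_of_lt_of_le (by omega) hN0 (by omega)
    omega
  refine ⟨longAndUnitJobs (k + P) k ((k + P + P) * N) ((k + P) * P * N) hm hS hQ, ?_⟩
  intro σ τ hσ hτ
  have hlow := le_cost_of_isWLRL hm hS hQ hσ
  have hup := (hτ.2 _ (isSlotting_longFirstSlots hm hS hQ (by omega)).isFeasible).trans
    (cost_longFirstSlots_le hm hS hQ (by omega))
  rw [lt_div_iff₀ hτ.1.cost_pos]
  refine (mul_le_mul_of_nonneg_left hup hα0).trans_lt (lt_of_lt_of_le ?_ hlow)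
  have hN' : (0 : ℝ) < N := by exact_mod_cast hN0
  have hP' : (0 : ℝ) < P := by exact_mod_cast hP
  have hmul := mul_lt_mul_of_pos_right hN hN'
  have hk0 : (0 : ℝ) ≤ k := Nat.cast_nonneg k
  push_cast
  have e : ((k : ℝ) + P) * ((k + P) * P * N) ^ 2 / (2 * (k + P - k)) =
      (k + P) ^ 3 * P * N ^ 2 / 2 := by
    rw [add_sub_cancel_left]
    field_simp
  rw [e]
  -- The weight `Q - 1` is rounded up to `Q`, so that the upper bound has only `N²` and `N` terms.
  have hdrop : α * (k * (((k : ℝ) + P + P) * N - 1) * (k + (k + P + P) * N * (k + P))) ≤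
      α * (k * (((k : ℝ) + P + P) * N) * (k + (k + P + P) * N * (k + P))) := by
    apply mul_le_mul_of_nonneg_left _ hα0
    apply mul_le_mul_of_nonneg_right _ (by positivity)
    apply mul_le_mul_of_nonneg_left _ hk0
    linarith
  linarith

end ReentrantShop

theorem mainTheorem3 (v : WLRLVariant) :
    (∀ I : ReentrantShop,
      (∃ σ : I.Schedule, I.IsWLRL v σ) ∧ ∃ τ : I.Schedule, I.IsOptimal τ ∧ I.IsPermutation τ) ∧
    (∀ (I : ReentrantShop) (σ τ : I.Schedule), I.IsWLRL v σ → I.IsOptimal τ →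
      I.cost σ / I.cost τ ≤ (1 + √2) / 2) ∧
    (∀ α : ℝ, α < (1 + √2) / 2 → ∃ I : ReentrantShop, ∀ σ τ : I.Schedule,
      I.IsWLRL v σ → I.IsOptimal τ → α < I.cost σ / I.cost τ) := by
  refine ⟨fun I => ?_, fun I σ τ hσ hτ => ?_, fun α hα => ReentrantShop.exists_bad_instance v hα⟩
  · obtain ⟨s, hs⟩ := I.exists_listSchedule Finset.univ
    exact ⟨⟨_, hs.isWLRL v⟩, ReentrantShop.exists_optimal_permutation hs.isSlotting⟩
  · rw [div_le_iff₀ hτ.1.cost_pos]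
    exact hσ.cost_le hτ.1
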